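/- Proposition 4.6. Let $d\ge 2$ and let $\mathcal K^d$ be the set of nonempty compact convex subsets of $\mathbb R^d$ with the Hausdorff metric. For nonnegative integers $p,q$ and $K\in\mathcal K^d$ put $$\xi_{p,q}(K)=\int_{\partial K}\langle s,n(s)\rangle^p\,|s|^{2q}\,d\sigma_K(s),$$ where $n(s)$ is the unit outer normal of $K$ at $s$ (unique for almost every $s\in\partial K$ if $K$ has interior points) and $\sigma_K$ is the surface area measure on $\partial K$, i.e. the $(d-1)$-dimensional Hausdorff measure, normalized to agree with Lebesgue measure. If $\dim K=d-1$, both sides of $K$ are counted: the integrand is the sum over the two unit normals $\pm n$ of the affine hull of $K$; if $\dim K\le d-2$, then $\xi_{p,q}(K)=0$. Then these integrals exist, and $\xi_{p,q}$ is an $O(d)$-invariant continuous valuation on $\mathcal K^d$, that is, $\xi_{p,q}(UK)=\xi_{p,q}(K)$ for every $U\in O(d)$, $\xi_{p,q}$ is continuous in the Hausdorff metric, and $\xi_{p,q}(K\cup L)+\xi_{p,q}(K\cap L)=\xi_{p,q}(K)+\xi_{p,q}(L)$ whenever $K,L,K\cup L\in\mathcal K^d$. Moreover $\xi_{p,q}$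 is polynomial of degree exactly $\ell$, where $\ell=p+2q$ if $p\ne 1$ and $\ell=2q$ if $p=1$: for each $K\in\mathcal K^d$ the function $x\mapsto\xi_{p,q}(K+x)$ is a polynomial in $x\in\mathbb R^d$ of degree at most $\ell$, and $\ell$ is the least nonnegative integer with this property. -/

import Mathlib

open MeasureTheory
open scoped RealInnerProductSpace

/-! Compact convex sets in `ℝ^d` are Mathlib's `ConvexBody (EuclideanSpace ℝ (Fin d))`: nonempty
compact convex sets (possibly with empty interior) with the Hausdorff metric. -/

namespace ConvexBody

section Ops

variable {E : Type*} [NormedAddCommGroup E] [NormedSpace ℝ E]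

/-- The translate `K + x`. -/
def translate (K : ConvexBody E) (x : E) : ConvexBody E where
  carrier := (fun s => s + x) '' (K : Set E)
  convex' := by simpa [add_comm] using K.convex.translate x
  isCompact' := K.isCompact.image (by fun_prop)
  nonempty' := K.nonempty.image _

/-- The image `U K` under a linear isometry `U`. -/
def mapIsometry (U : E ≃ₗᵢ[ℝ] E) (K : ConvexBody E) : ConvexBody E where
  carrier := U '' (K : Set E)
  convex' := K.convex.is_linear_image U.toLinearEquiv.toLinearMap.isLinear
  isCompact' := K.isCompact.image U.continuous
  nonempty' := K.nonempty.image _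

/-- Two nonempty compact sets whose union is convex have a common point. -/
theorem inter_nonempty_of_convex_union (K L : ConvexBody E)
    (h : Convex ℝ ((K : Set E) ∪ L)) : ((K : Set E) ∩ L).Nonempty := by
  have hc := isPreconnected_closed_iff.1 h.isPreconnected (K : Set E) L K.isClosed L.isClosed
    subset_rfl
    (K.nonempty.mono fun x hx => ⟨Or.inl hx, hx⟩) (L.nonempty.mono fun x hx => ⟨Or.inr hx, hx⟩)
  exact hc.mono Set.inter_subset_right

/-- The union `K ∪ L`, when it is convex. -/
def union (K L : ConvexBody E) (h : Convex ℝ ((K : Set E) ∪ L)) : ConvexBody E where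
  carrier := (K : Set E) ∪ L
  convex' := h
  isCompact' := K.isCompact.union L.isCompact
  nonempty' := K.nonempty.mono Set.subset_union_left

/-- The intersection `K ∩ L`, when `K ∪ L` is convex (so that it is nonempty). -/
def inter (K L : ConvexBody E) (h : Convex ℝ ((K : Set E) ∪ L)) : ConvexBody E where
  carrier := (K : Set E) ∩ L
  convex' := K.convex.inter L.convex
  isCompact' := K.isCompact.inter L.isCompact
  nonempty' := inter_nonempty_of_convex_union K L h

/-- `φ` is a valuation: `φ(K ∪ L) + φ(K ∩ L) = φ(K) + φ(L)` whenever `K ∪ L` is convex. -/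
def IsValuation (φ : ConvexBody E → ℝ) : Prop :=
  ∀ (K L : ConvexBody E) (h : Convex ℝ ((K : Set E) ∪ L)),
    φ (K.union L h) + φ (K.inter L h) = φ K + φ L

/-- `φ` is `O(d)`-invariant: `φ(U K) = φ(K)` for every linear isometry `U`. -/
def IsOrthogonalInvariant (φ : ConvexBody E → ℝ) : Prop :=
  ∀ (U : E ≃ₗᵢ[ℝ] E) (K : ConvexBody E), φ (K.mapIsometry U) = φ K

end Ops

section Euclidean

variable {d : ℕ}

/-- `φ` is polynomial of degree at most `m`: for each `K`, `φ(K + x)` is a polynomial in the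
coordinates of `x` of total degree at most `m`. -/
def IsPolynomialOfDegreeLE (φ : ConvexBody (EuclideanSpace ℝ (Fin d)) → ℝ) (m : ℕ) : Prop :=
  ∀ K : ConvexBody (EuclideanSpace ℝ (Fin d)), ∃ P : MvPolynomial (Fin d) ℝ,
    P.totalDegree ≤ m ∧
      ∀ x : EuclideanSpace ℝ (Fin d), φ (K.translate x) = MvPolynomial.eval (fun i => x i) P

/-- `φ` is polynomial of degree (exactly) `l`: `l` is the least `m` such that `φ` is polynomial of
degree at most `m`. -/
def HasPolynomialDegree (φ : ConvexBody (EuclideanSpace ℝ (Fin d)) → ℝ) (l : ℕ) : Prop :=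
  IsLeast {m : ℕ | IsPolynomialOfDegreeLE φ m} l

/-- The set of unit outer normals of `K` at `s`. For `s` on the boundary of `K`, outside a set of
`(d-1)`-dimensional Hausdorff measure zero, it consists of one vector `n(s)` if `K` has interior
points, and of the two vectors `± n` normal to the affine hull of `K` if `dim K = d - 1`. -/
def unitOuterNormals (K : ConvexBody (EuclideanSpace ℝ (Fin d))) (s : EuclideanSpace ℝ (Fin d)) :
    Set (EuclideanSpace ℝ (Fin d)) :=
  {n | ‖n‖ = 1 ∧ ∀ y ∈ K, ⟪y - s, n⟫ ≤ 0}

/-- The integrand `⟨s, n(s)⟩ ^ p * |s| ^ (2 q)`, summed over the unit outer normals at `s`: a single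
term at almost every boundary point of a body with interior points; one term for each of the two
sides of a body of dimension `d - 1`. -/
noncomputable def xiIntegrand (p q : ℕ) (K : ConvexBody (EuclideanSpace ℝ (Fin d)))
    (s : EuclideanSpace ℝ (Fin d)) : ℝ :=
  ∑ᶠ n ∈ K.unitOuterNormals s, ⟪s, n⟫ ^ p * ‖s‖ ^ (2 * q)

/-- `ξ_{p,q}(K) = ∫_{∂K} ⟨s, n(s)⟩ ^ p |s| ^ (2 q) dσ_K(s)`, where `σ_K` is surface area, i.e. the
`(d-1)`-dimensional Hausdorff measure (normalized as Lebesgue measure) on the boundary of `K`, each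
point of which is counted once for each outer normal. In particular `ξ_{p,q}(K) = 0` if
`dim K ≤ d - 2`, because then the boundary is a null set. -/
noncomputable def xi (p q : ℕ) (K : ConvexBody (EuclideanSpace ℝ (Fin d))) : ℝ :=
  ∫ s in frontier (K : Set (EuclideanSpace ℝ (Fin d))), xiIntegrand p q K s ∂μHE[d - 1]

end Euclidean

end ConvexBody

/-! The integrand depends only on a point `s` and a unit normal `n` there, so most of the work is
done for `normalIntegral`: the integral over the boundary of an arbitrary continuous `f (s, n)`,
summed over the normals at `s`. Full-dimensional and flat bodies are then treated alike.

The device is to look along a unit vector `ν`. Up to a null set, the boundary points with a normal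
satisfying `⟪n, ν⟫ > 0` form the graph of a concave function over the regular part of the projection
of `K` to the hyperplane orthogonal to `ν`. The area density of this graph is `1 / ⟪n, ν⟫`, so
integrating `f` with weight `max ⟪n, ν⟫ 0` gives a Lebesgue integral over the projection
(`normalIntegral_mul_innerNormalPos`). Since `∑ ⟪n, b i⟫ ^ 2 = 1` for an orthonormal basis `b`,
every normal integral is a finite sum of such integrals (`normalIntegral_eq`). They exist because
`f` is bounded on bounded sets. They are continuous in `K` by dominated convergence, because over
almost every point the top point and its normal converge (`tendsto_topPoint_topNormal`).

The valuation property holds pointwise: the normal sets of `K ∪ L` and `K ∩ L` at `s` have the same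
union and the same intersection as those of `K` and `L`. Invariance holds because isometries
transport both normals and area.

Translation by `x` replaces `s` by `s + x`, which turns the integrand into a polynomial in `x` of
degree at most `p + 2 * q`, with continuous coefficients. For `p = 1` the only term of degree `2 * q
+ 1` is `⟪x, n⟫ * ‖x‖ ^ (2 * q)`; it integrates to zero because the projections seen from `ν` and
`-ν` have equal volume (`normalIntegral_innerNormal`). Sharpness is tested along a line `x = r • e`.
For `p ≠ 1` the coefficient of `r ^ (p + 2 * q)` is the integral of `⟪n, e⟫ ^ p`, nonzero for a half
ball. For `p = 1` and `q ≠ 0` the coefficient of `r ^ (2 * q)` is positive for the unit ball. -/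

open scoped ENNReal NNReal Topology

set_option linter.unusedSectionVars false

/-! ### The area density of a graph -/

section AreaDensity

variable {V : Type*} [NormedAddCommGroup V]

/-- The area density of a graph of slope `a`. -/
noncomputable def areaDensity (a : V) : ℝ≥0 := ⟨√(1 + ‖a‖ ^ 2), Real.sqrt_nonneg _⟩

theorem coe_areaDensity (a : V) : (areaDensity a : ℝ) = √(1 + ‖a‖ ^ 2) := rfl

theorem measurable_areaDensity [MeasurableSpace V] [OpensMeasurableSpace V] : Measurable (areaDensity : V → ℝ≥0) :=
  Measurable.subtype_mk (by fun_prop)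

theorem one_le_areaDensity (a : V) : 1 ≤ areaDensity a := by
  rw [← NNReal.coe_le_coe, coe_areaDensity, NNReal.coe_one, Real.one_le_sqrt]
  nlinarith [sq_nonneg ‖a‖]

/-- The density is 1-Lipschitz in the slope and at least 1, so an additive error `δ` is also a
relative one. -/
theorem areaDensity_le {a b : V} {δ : ℝ≥0} (h : dist a b ≤ δ) :
    areaDensity a ≤ (1 + δ) * areaDensity b := by
  have h1 : (areaDensity a : ℝ) ≤ areaDensity b + δ := by
    have hb := one_le_areaDensity b
    rw [← NNReal.coe_le_coe] at hb
    rw [coe_areaDensity, coe_areaDensity] at *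
    have hab : ‖a‖ ≤ ‖b‖ + δ := by
      have := norm_sub_norm_le a b
      rw [← dist_eq_norm] at this
      linarith
    have hs := Real.sq_sqrt (show 0 ≤ 1 + ‖b‖ ^ 2 by positivity)
    have hbs : ‖b‖ ≤ √(1 + ‖b‖ ^ 2) := Real.le_sqrt_of_sq_le (by linarith)
    apply Real.sqrt_le_iff.2 ⟨by positivity, ?_⟩
    nlinarith [norm_nonneg a, norm_nonneg b, δ.coe_nonneg, mul_le_mul_of_nonneg_right hbs δ.coe_nonneg]
  rw [← NNReal.coe_le_coe]
  push_cast
  have := one_le_areaDensity b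
  rw [← NNReal.coe_le_coe] at this
  push_cast at this
  nlinarith [δ.coe_nonneg]

end AreaDensity

/-! ### The area formula for graphs with supergradients -/

section GraphArea

variable {V E : Type*} [NormedAddCommGroup V] [InnerProductSpace ℝ V] [FiniteDimensional ℝ V]
  [MeasurableSpace V] [BorelSpace V]
  [NormedAddCommGroup E] [InnerProductSpace ℝ E] [MeasurableSpace E] [BorelSpace E]

/-- The linear map `y ↦ ι y + ⟨a, y⟩ ν` whose range is a hyperplane of slope `a`. -/
noncomputable def linearGraph (ι : V →ₗᵢ[ℝ] E) (ν : E) (a : V) : V →ₗ[ℝ] E :=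
  ι.toLinearMap + (innerₛₗ ℝ a).smulRight ν

theorem linearGraph_apply (ι : V →ₗᵢ[ℝ] E) (ν : E) (a y : V) :
    linearGraph ι ν a y = ι y + ⟪a, y⟫ • ν := rfl

/-- In an orthonormal basis the Gram matrix is the identity plus the rank-one matrix of `a`, and its
determinant is `1 + ‖a‖ ^ 2`. -/
theorem normDet_linearGraph (ι : V →ₗᵢ[ℝ] E) {ν : E} (hν : ‖ν‖ = 1) (hperp : ∀ v, ⟪ι v, ν⟫ = 0)
    (a : V) : (linearGraph ι ν a).normDet = √(1 + ‖a‖ ^ 2) := by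
  have hperp' : ∀ v, ⟪ν, ι v⟫ = 0 := fun v => by rw [real_inner_comm, hperp]
  let b := stdOrthonormalBasis ℝ V
  have h := (linearGraph ι ν a).normDet_sq_eq_det_gram b
  have hg : Matrix.gram ℝ (fun i => linearGraph ι ν a (b i)) =
      1 + Matrix.replicateCol Unit (fun i => ⟪a, b i⟫) *
        Matrix.replicateRow Unit (fun i => ⟪a, b i⟫) := by
    ext i j
    have hij : ⟪b i, b j⟫ = if i = j then (1 : ℝ) else 0 :=
      (orthonormal_iff_ite.mp b.orthonormal) i j
    simp [Matrix.gram, linearGraph_apply, inner_add_left, inner_add_right, inner_smul_left,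
      inner_smul_right, hperp, hperp', hij, hν, Matrix.one_apply, Matrix.mul_apply, mul_comm]
  have hn : (fun i => ⟪a, b i⟫) ⬝ᵥ (fun i => ⟪a, b i⟫) = ‖a‖ ^ 2 := by
    rw [← b.sum_sq_norm_inner_left a]
    simp [dotProduct, ← sq]
  have h2 : (linearGraph ι ν a).normDet ^ 2 = 1 + ‖a‖ ^ 2 := by
    have : (linearGraph ι ν a).normDet ^ 2 =
      (Matrix.gram ℝ (fun i => linearGraph ι ν a (b i))).det := by simpa using h
    rw [this, hg, Matrix.det_one_add_replicateCol_mul_replicateRow, hn]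
  rw [← h2, Real.sqrt_sq (LinearMap.normDet_nonneg _)]

/-- On `B` the map `F` factors through `G`, since equal values of `G` force equal values of `F`, and
the factor is `C`-Lipschitz on `G '' B`. This compares two images of one set with no regularity of
`F` or `G` separately. -/
theorem euclideanHausdorffMeasure_image_le_of_dist_le {X Y Z : Type*} [MetricSpace Y]
    [MeasurableSpace Y] [BorelSpace Y] [MetricSpace Z] [MeasurableSpace Z] [BorelSpace Z]
    [Nonempty X] {F : X → Y} {G : X → Z} {C : ℝ≥0} {B : Set X} (m : ℕ)
    (h : ∀ x ∈ B, ∀ y ∈ B, dist (F x) (F y) ≤ C * dist (G x) (G y)) :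
    μHE[m] (F '' B) ≤ (C : ℝ≥0∞) ^ m * μHE[m] (G '' B) := by
  have hinv : ∀ x ∈ B, Function.invFunOn G B (G x) ∈ B ∧ G (Function.invFunOn G B (G x)) = G x :=
    fun x hx => Function.invFunOn_pos ⟨x, hx, rfl⟩
  have heq : ∀ x ∈ B, F (Function.invFunOn G B (G x)) = F x := fun x hx => by
    have := h _ (hinv x hx).1 x hx
    rw [(hinv x hx).2, dist_self, mul_zero] at this
    exact dist_le_zero.1 this
  have himg : (fun z => F (Function.invFunOn G B z)) '' (G '' B) = F '' B := by
    rw [Set.image_image]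
    exact Set.image_congr heq
  have hl : LipschitzOnWith C (fun z => F (Function.invFunOn G B z)) (G '' B) := by
    refine LipschitzOnWith.of_dist_le_mul ?_
    rintro _ ⟨x, hx, rfl⟩ _ ⟨y, hy, rfl⟩
    rw [heq x hx, heq y hy]
    exact h x hx y hy
  have := hl.hausdorffMeasure_image_le (d := m) (by positivity)
  rw [himg, ENNReal.rpow_natCast] at this
  simp only [Measure.euclideanHausdorffMeasure_def, Measure.smul_apply]
  rw [mul_smul_comm]
  gcongr

/-- The graph map of `h` in direction `ν`. -/
def graphMap (ι : V →ₗᵢ[ℝ] E) (ν : E) (h : V → ℝ) (y : V) : E := ι y + h y • ν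

variable {ι : V →ₗᵢ[ℝ] E} {ν : E} {h : V → ℝ} {a : V → V} {D : Set V}

theorem norm_le_norm_add_smul {V E : Type*} [NormedAddCommGroup V] [InnerProductSpace ℝ V]
    [NormedAddCommGroup E] [InnerProductSpace ℝ E] {ι : V →ₗᵢ[ℝ] E} {ν : E} (hν : ‖ν‖ = 1) (hperp : ∀ v, ⟪ι v, ν⟫ = 0) (v : V) (t : ℝ) :
    ‖v‖ ≤ ‖ι v + t • ν‖ := by
  have : ‖ι v + t • ν‖ ^ 2 = ‖v‖ ^ 2 + t ^ 2 := by
    rw [norm_add_sq_real, inner_smul_right, hperp, norm_smul, hν]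
    simp
  exact (sq_le_sq₀ (norm_nonneg _) (norm_nonneg _)).1 (by nlinarith [sq_nonneg t])

theorem graphMap_injective {V E : Type*} [NormedAddCommGroup V] [InnerProductSpace ℝ V]
    [NormedAddCommGroup E] [InnerProductSpace ℝ E] {ι : V →ₗᵢ[ℝ] E} {ν : E} {h : V → ℝ} (hν : ‖ν‖ = 1) (hperp : ∀ v, ⟪ι v, ν⟫ = 0) :
    Function.Injective (graphMap ι ν h) := by
  intro y y' hy
  have := norm_le_norm_add_smul (ι := ι) hν hperp (y - y') (h y - h y')
  have h0 : ι (y - y') + (h y - h y') • ν = 0 := by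
    rw [map_sub, sub_smul]
    have : graphMap ι ν h y - graphMap ι ν h y' = 0 := sub_eq_zero.2 hy
    rw [← this, graphMap, graphMap]; abel
  rw [h0, norm_zero] at this
  exact sub_eq_zero.1 (norm_le_zero_iff.1 this)

/-- Supergradients that are nearly constant make the graph nearly linear. -/
theorem abs_sub_sub_inner_le {B : Set V} {δ : ℝ} {a₀ : V}
    (ha : ∀ y ∈ B, ∀ y' ∈ B, h y' - h y ≤ ⟪a y, y' - y⟫) (hδ : ∀ y ∈ B, dist (a y) a₀ ≤ δ)
    {y y' : V} (hy : y ∈ B) (hy' : y' ∈ B) : |h y - h y' - ⟪a₀, y - y'⟫| ≤ δ * ‖y - y'‖ := by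
  have key : ∀ y ∈ B, ∀ z : V, |⟪a y - a₀, z⟫| ≤ δ * ‖z‖ := fun y hy z =>
    (abs_real_inner_le_norm _ _).trans <| by
      gcongr; rw [← dist_eq_norm]; exact hδ y hy
  have h1 := ha y hy y' hy'
  have h2 := ha y' hy' y hy
  have k1 := abs_le.1 (key y hy (y - y'))
  have k2 := abs_le.1 (key y' hy' (y - y'))
  rw [inner_sub_left] at k1 k2
  have e : ⟪a y, y' - y⟫ = -⟪a y, y - y'⟫ := by rw [← inner_neg_right, neg_sub]
  rw [abs_le]
  constructor <;> linarith

theorem dist_graphMap_sub_linearGraph_le (hν : ‖ν‖ = 1) {B : Set V} {δ : ℝ} {a₀ : V}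
    (ha : ∀ y ∈ B, ∀ y' ∈ B, h y' - h y ≤ ⟪a y, y' - y⟫) (hδ : ∀ y ∈ B, dist (a y) a₀ ≤ δ)
    {y y' : V} (hy : y ∈ B) (hy' : y' ∈ B) :
    ‖(graphMap ι ν h y - graphMap ι ν h y') -
      (linearGraph ι ν a₀ y - linearGraph ι ν a₀ y')‖ ≤ δ * ‖y - y'‖ := by
  have : (graphMap ι ν h y - graphMap ι ν h y') -
      (linearGraph ι ν a₀ y - linearGraph ι ν a₀ y') = (h y - h y' - ⟪a₀, y - y'⟫) • ν := by
    simp only [graphMap, linearGraph_apply, inner_sub_right, sub_smul]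
    abel
  rw [this, norm_smul, hν, mul_one, Real.norm_eq_abs]
  exact abs_sub_sub_inner_le ha hδ hy hy'

/-- Where all slopes are within `δ` of `a₀`, the graph and the hyperplane of slope `a₀` are
Lipschitz images of each other with constant `1 + δ`. This costs one factor `1 + δ` per dimension;
replacing the density at `a y` by that at `a₀` costs one more. -/
theorem euclideanHausdorffMeasure_graphMap_cell (hν : ‖ν‖ = 1) (hperp : ∀ v, ⟪ι v, ν⟫ = 0)
    {B : Set V} (hB : MeasurableSet B) {δ : ℝ≥0} {a₀ : V}
    (ha : ∀ y ∈ B, ∀ y' ∈ B, h y' - h y ≤ ⟪a y, y' - y⟫) (hδ : ∀ y ∈ B, dist (a y) a₀ ≤ δ) :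
    μHE[Module.finrank ℝ V] (graphMap ι ν h '' B) ≤
      ((1 + δ : ℝ≥0) : ℝ≥0∞) ^ (Module.finrank ℝ V + 1) * ∫⁻ y in B, areaDensity (a y) ∧
    ∫⁻ y in B, areaDensity (a y) ≤ ((1 + δ : ℝ≥0) : ℝ≥0∞) ^ (Module.finrank ℝ V + 1) *
      μHE[Module.finrank ℝ V] (graphMap ι ν h '' B) := by
  have hlin : μHE[Module.finrank ℝ V] (linearGraph ι ν a₀ '' B) =
      (areaDensity a₀ : ℝ≥0∞) * volume B := by
    rw [LinearMap.euclideanHausdorffMeasure_image_eq_normDet_mul_volume,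
      normDet_linearGraph ι hν hperp, ← coe_areaDensity, ENNReal.ofReal_coe_nnreal]
  have hlow : (∫⁻ y in B, areaDensity (a y)) ≤
      ((1 + δ : ℝ≥0) : ℝ≥0∞) * ((areaDensity a₀ : ℝ≥0∞) * volume B) := by
    rw [← mul_assoc, ← ENNReal.coe_mul, ← setLIntegral_const]
    refine setLIntegral_mono' hB fun y hy => ?_
    exact_mod_cast areaDensity_le (hδ y hy)
  have hup : (areaDensity a₀ : ℝ≥0∞) * volume B ≤
      ((1 + δ : ℝ≥0) : ℝ≥0∞) * ∫⁻ y in B, areaDensity (a y) := by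
    rw [← lintegral_const_mul' _ _ ENNReal.coe_ne_top, ← setLIntegral_const]
    refine setLIntegral_mono' hB fun y hy => ?_
    exact_mod_cast areaDensity_le (by rw [dist_comm]; exact hδ y hy)
  have n1 : ∀ y ∈ B, ∀ y' ∈ B, ‖y - y'‖ ≤ ‖graphMap ι ν h y - graphMap ι ν h y'‖ := by
    intro y _ y' _
    convert norm_le_norm_add_smul (ι := ι) hν hperp (y - y') (h y - h y') using 2
    simp only [graphMap, map_sub, sub_smul]; abel
  have n2 : ∀ y ∈ B, ∀ y' ∈ B, ‖y - y'‖ ≤ ‖linearGraph ι ν a₀ y - linearGraph ι ν a₀ y'‖ := by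
    intro y _ y' _
    rw [← map_sub, linearGraph_apply]
    exact norm_le_norm_add_smul hν hperp _ _
  have c1 : μHE[Module.finrank ℝ V] (graphMap ι ν h '' B) ≤
      ((1 + δ : ℝ≥0) : ℝ≥0∞) ^ Module.finrank ℝ V *
        μHE[Module.finrank ℝ V] (linearGraph ι ν a₀ '' B) := by
    refine euclideanHausdorffMeasure_image_le_of_dist_le _ fun y hy y' hy' => ?_
    have := dist_graphMap_sub_linearGraph_le (ι := ι) hν ha hδ hy hy'
    have h3 := norm_sub_norm_le (graphMap ι ν h y - graphMap ι ν h y')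
      (linearGraph ι ν a₀ y - linearGraph ι ν a₀ y')
    rw [dist_eq_norm, dist_eq_norm]
    push_cast
    nlinarith [mul_le_mul_of_nonneg_left (n2 y hy y' hy') δ.coe_nonneg]
  have c2 : μHE[Module.finrank ℝ V] (linearGraph ι ν a₀ '' B) ≤
      ((1 + δ : ℝ≥0) : ℝ≥0∞) ^ Module.finrank ℝ V *
        μHE[Module.finrank ℝ V] (graphMap ι ν h '' B) := by
    refine euclideanHausdorffMeasure_image_le_of_dist_le _ fun y hy y' hy' => ?_
    have := dist_graphMap_sub_linearGraph_le (ι := ι) hν ha hδ hy hy'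
    have h3 := norm_sub_norm_le (linearGraph ι ν a₀ y - linearGraph ι ν a₀ y')
      (graphMap ι ν h y - graphMap ι ν h y')
    rw [norm_sub_rev] at this
    rw [dist_eq_norm, dist_eq_norm]
    push_cast
    nlinarith [mul_le_mul_of_nonneg_left (n1 y hy y' hy') δ.coe_nonneg]
  constructor
  · refine c1.trans ?_
    rw [hlin, pow_succ, mul_assoc]
    gcongr
  · refine hlow.trans ?_
    rw [pow_succ', mul_assoc, ← hlin]
    gcongr

/-- The area formula for the graph of a function with measurably chosen supergradients. -/
theorem euclideanHausdorffMeasure_graphMap_image (hν : ‖ν‖ = 1) (hperp : ∀ v, ⟪ι v, ν⟫ = 0)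
    (hD : MeasurableSet D) (ham : Measurable a)
    (ha : ∀ y ∈ D, ∀ y' ∈ D, h y' - h y ≤ ⟪a y, y' - y⟫) :
    μHE[Module.finrank ℝ V] (graphMap ι ν h '' D) = ∫⁻ y in D, areaDensity (a y) := by
  have main : ∀ δ : ℝ≥0, 0 < δ →
      μHE[Module.finrank ℝ V] (graphMap ι ν h '' D) ≤
        ((1 + δ : ℝ≥0) : ℝ≥0∞) ^ (Module.finrank ℝ V + 1) * ∫⁻ y in D, areaDensity (a y) ∧
      ∫⁻ y in D, areaDensity (a y) ≤ ((1 + δ : ℝ≥0) : ℝ≥0∞) ^ (Module.finrank ℝ V + 1) *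
        μHE[Module.finrank ℝ V] (graphMap ι ν h '' D) := by
    intro δ hδ
    -- A countable measurable partition into cells on which the slope is constant up to `δ`.
    let C : ℕ → Set V := disjointed fun k => a ⁻¹' Metric.closedBall (TopologicalSpace.denseSeq V k) δ
    have hCm : ∀ k, MeasurableSet (C k) :=
      MeasurableSet.disjointed fun k => ham Metric.isClosed_closedBall.measurableSet
    have hCd : Pairwise (Function.onFun Disjoint C) := disjoint_disjointed _
    have hCu : ⋃ k, C k = Set.univ := by
      rw [iUnion_disjointed, Set.eq_univ_iff_forall]
      intro y
      obtain ⟨k, hk⟩ := (TopologicalSpace.denseRange_denseSeq V).exists_dist_lt (a y)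
        (show (0 : ℝ) < δ from hδ)
      exact Set.mem_iUnion.2 ⟨k, hk.le⟩
    have hCδ : ∀ k, ∀ y ∈ D ∩ C k, dist (a y) (TopologicalSpace.denseSeq V k) ≤ δ :=
      fun k y hy => (disjointed_subset (fun k => a ⁻¹' Metric.closedBall
        (TopologicalSpace.denseSeq V k) (δ : ℝ)) k hy.2 : _)
    have hDC : D = ⋃ k, D ∩ C k := by rw [← Set.inter_iUnion, hCu, Set.inter_univ]
    have cell := fun k => euclideanHausdorffMeasure_graphMap_cell (ι := ι) hν hperp
      (hD.inter (hCm k)) (fun y hy y' hy' => ha y hy.1 y' hy'.1) (hCδ k)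
    have hint : ∫⁻ y in D, (areaDensity (a y) : ℝ≥0∞) =
        ∑' k, ∫⁻ y in D ∩ C k, areaDensity (a y) := by
      conv_lhs => rw [hDC]
      exact lintegral_iUnion (fun k => hD.inter (hCm k))
        (fun i j hij => (hCd hij).mono Set.inter_subset_right Set.inter_subset_right) _
    -- On a cell the slopes are bounded, so `h` is Lipschitz there. An injective continuous image of
    -- a Borel set is Borel, which makes the measures of the pieces add up.
    have hcont : ∀ k, ContinuousOn (graphMap ι ν h) (D ∩ C k) := by
      intro k
      set a₀ := TopologicalSpace.denseSeq V k
      have hh : LipschitzOnWith (‖a₀‖₊ + δ) h (D ∩ C k) := by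
        refine LipschitzOnWith.of_dist_le_mul fun y hy y' hy' => ?_
        have h1 := abs_sub_sub_inner_le (fun y hy y' hy' => ha y hy.1 y' hy'.1) (hCδ k) hy hy'
        have h2 := abs_real_inner_le_norm a₀ (y - y')
        rw [Real.dist_eq, dist_eq_norm]
        push_cast
        have h3 := abs_add_le (h y - h y' - ⟪a₀, y - y'⟫) ⟪a₀, y - y'⟫
        rw [sub_add_cancel] at h3
        linarith
      exact ι.continuous.continuousOn.add (hh.continuousOn.smul continuousOn_const)
    have hmeas : ∀ k, MeasurableSet (graphMap ι ν h '' (D ∩ C k)) := fun k =>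
      (hD.inter (hCm k)).image_of_continuousOn_injOn (hcont k)
        (graphMap_injective hν hperp).injOn
    have himg : graphMap ι ν h '' D = ⋃ k, graphMap ι ν h '' (D ∩ C k) := by
      conv_lhs => rw [hDC, Set.image_iUnion]
    have hsum : μHE[Module.finrank ℝ V] (graphMap ι ν h '' D) =
        ∑' k, μHE[Module.finrank ℝ V] (graphMap ι ν h '' (D ∩ C k)) := by
      rw [himg]
      refine measure_iUnion (fun i j hij => ?_) hmeas
      exact (Set.disjoint_image_iff (graphMap_injective hν hperp)).2
        ((hCd hij).mono Set.inter_subset_right Set.inter_subset_right)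
    rw [hint, hsum, ← ENNReal.tsum_mul_left, ← ENNReal.tsum_mul_left]
    exact ⟨ENNReal.tsum_le_tsum fun k => (cell k).1, ENNReal.tsum_le_tsum fun k => (cell k).2⟩
  have lim : ∀ X Y : ℝ≥0∞, (∀ δ : ℝ≥0, 0 < δ →
      X ≤ ((1 + δ : ℝ≥0) : ℝ≥0∞) ^ (Module.finrank ℝ V + 1) * Y) → X ≤ Y := by
    intro X Y hXY
    have ht : Filter.Tendsto (fun δ : ℝ≥0 => ((1 + δ : ℝ≥0) : ℝ≥0∞) ^ (Module.finrank ℝ V + 1) * Y)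
        (nhdsWithin 0 (Set.Ioi 0)) (nhds Y) := by
      have h1 : Filter.Tendsto (fun δ : ℝ≥0 => (((1 + δ) ^ (Module.finrank ℝ V + 1) : ℝ≥0) : ℝ≥0∞))
          (nhdsWithin 0 (Set.Ioi 0)) (nhds ((1 : ℝ≥0) : ℝ≥0∞)) := by
        refine ENNReal.tendsto_coe.2 (tendsto_nhdsWithin_of_tendsto_nhds ?_)
        have : Continuous fun δ : ℝ≥0 => (1 + δ) ^ (Module.finrank ℝ V + 1) := by fun_prop
        simpa using this.tendsto 0
      have h2 := ENNReal.Tendsto.mul_const (b := Y) h1 (Or.inl (by simp))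
      simpa using h2
    refine ge_of_tendsto ht ?_
    filter_upwards [self_mem_nhdsWithin] with δ hδ using hXY δ hδ
  exact le_antisymm (lim _ _ fun δ hδ => (main δ hδ).1) (lim _ _ fun δ hδ => (main δ hδ).2)

end GraphArea

/-! ### Orthogonal splitting along a unit vector -/

section Hyperplane

variable {E : Type*} [NormedAddCommGroup E] [InnerProductSpace ℝ E]

/-- The hyperplane orthogonal to `ν`. -/
noncomputable abbrev normalHyperplane (ν : E) : Submodule ℝ E := (ℝ ∙ ν)ᗮ

/-- Orthogonal projection onto the hyperplane orthogonal to `ν`. -/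
noncomputable abbrev hyperplaneProj (ν : E) : E →L[ℝ] normalHyperplane ν :=
  (normalHyperplane ν).orthogonalProjectionOnto

theorem inner_coe_normalHyperplane (ν : E) (v : normalHyperplane ν) : ⟪(v : E), ν⟫ = 0 :=
  Submodule.mem_orthogonal_singleton_iff_inner_left.1 v.2

theorem hyperplaneProj_add_inner_smul {ν : E} (hν : ‖ν‖ = 1) (z : E) :
    (hyperplaneProj ν z : E) + ⟪z, ν⟫ • ν = z := by
  have h := Submodule.starProjection_add_starProjection_orthogonal (K := ℝ ∙ ν) z
  rw [Submodule.starProjection_unit_singleton ℝ hν] at h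
  rw [add_comm, real_inner_comm]
  exact h

theorem hyperplaneProj_add_smul (ν : E) (v : normalHyperplane ν) (t : ℝ) :
    hyperplaneProj ν ((v : E) + t • ν) = v := by
  rw [map_add, map_smul, Submodule.orthogonalProjectionOnto_mem_subspace_eq_self,
    Submodule.orthogonalProjectionOnto_orthogonalComplement_singleton_eq_zero, smul_zero, add_zero]

theorem inner_eq_inner_hyperplaneProj_add {ν : E} (hν : ‖ν‖ = 1) (x n : E) :
    ⟪x, n⟫ = ⟪hyperplaneProj ν x, hyperplaneProj ν n⟫ + ⟪x, ν⟫ * ⟪n, ν⟫ := by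
  conv_lhs => rw [← hyperplaneProj_add_inner_smul hν x, ← hyperplaneProj_add_inner_smul hν n]
  have h2 : ⟪ν, (hyperplaneProj ν n : E)⟫ = 0 := by
    rw [real_inner_comm, inner_coe_normalHyperplane]
  simp only [inner_add_left, inner_add_right, inner_smul_left, inner_smul_right,
    inner_coe_normalHyperplane, h2, real_inner_self_eq_norm_sq, hν, Submodule.coe_inner]
  simp [mul_comm]

end Hyperplane

/-! ### The upper boundary as the graph of a concave function -/

namespace ConvexBody

variable {E : Type*} [NormedAddCommGroup E] [InnerProductSpace ℝ E]

/-- The unit outer normals of `K` at `s`, empty if `s ∉ K`. -/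
def normals (K : ConvexBody E) (s : E) : Set E :=
  {n | s ∈ K ∧ ‖n‖ = 1 ∧ ∀ y ∈ K, ⟪y - s, n⟫ ≤ 0}

/-- The orthogonal projection of `K` to the hyperplane orthogonal to `ν`. -/
noncomputable def shadow (K : ConvexBody E) (ν : E) : Set (normalHyperplane ν) :=
  hyperplaneProj ν '' (K : Set E)

/-- The height of the highest point of `K` above `y`, in direction `ν`. -/
noncomputable def topHeight (K : ConvexBody E) (ν : E) (y : normalHyperplane ν) : ℝ :=
  sSup ((fun z => ⟪z, ν⟫) '' ((K : Set E) ∩ hyperplaneProj ν ⁻¹' {y}))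

/-- The highest point of `K` above `y`, in direction `ν`. -/
noncomputable def topPoint (K : ConvexBody E) (ν : E) : normalHyperplane ν → E :=
  graphMap (normalHyperplane ν).subtypeₗᵢ ν (K.topHeight ν)

theorem topPoint_eq (K : ConvexBody E) (ν : E) (y : normalHyperplane ν) :
    K.topPoint ν y = y + K.topHeight ν y • ν := rfl

variable {K : ConvexBody E} {ν : E}

theorem isCompact_shadow : IsCompact (K.shadow ν) := K.isCompact.image (hyperplaneProj ν).continuous

theorem convex_shadow : Convex ℝ (K.shadow ν) :=
  K.convex.is_linear_image (hyperplaneProj ν).toLinearMap.isLinear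

theorem hyperplaneProj_mem_shadow {z : E} (hz : z ∈ K) : hyperplaneProj ν z ∈ K.shadow ν :=
  ⟨z, hz, rfl⟩

theorem isCompact_heights (y : normalHyperplane ν) :
    IsCompact ((fun z => ⟪z, ν⟫) '' ((K : Set E) ∩ hyperplaneProj ν ⁻¹' {y})) :=
  (K.isCompact.inter_right (isClosed_singleton.preimage (hyperplaneProj ν).continuous)).image
    (by fun_prop)

theorem inner_le_topHeight {z : E} (hz : z ∈ K) :
    ⟪z, ν⟫ ≤ K.topHeight ν (hyperplaneProj ν z) :=
  le_csSup (isCompact_heights _).bddAbove ⟨z, ⟨hz, rfl⟩, rfl⟩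

theorem topPoint_mem (hν : ‖ν‖ = 1) {y : normalHyperplane ν} (hy : y ∈ K.shadow ν) :
    K.topPoint ν y ∈ K := by
  obtain ⟨z, hz, rfl⟩ := hy
  obtain ⟨w, ⟨hw, hwz⟩, hwt⟩ := (isCompact_heights (K := K) (hyperplaneProj ν z)).sSup_mem
    ⟨_, z, ⟨hz, rfl⟩, rfl⟩
  have : K.topPoint ν (hyperplaneProj ν z) = w := by
    rw [topPoint_eq, topHeight, ← hwt, ← hwz]
    exact hyperplaneProj_add_inner_smul hν w
  rw [this]
  exact hw

theorem hyperplaneProj_topPoint (y : normalHyperplane ν) :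
    hyperplaneProj ν (K.topPoint ν y) = y := hyperplaneProj_add_smul ν y _

theorem inner_topPoint (hν : ‖ν‖ = 1) (y : normalHyperplane ν) :
    ⟪K.topPoint ν y, ν⟫ = K.topHeight ν y := by
  rw [topPoint_eq, inner_add_left, inner_coe_normalHyperplane, inner_smul_left,
    real_inner_self_eq_norm_sq, hν]
  simp

theorem concaveOn_topHeight (hν : ‖ν‖ = 1) : ConcaveOn ℝ (K.shadow ν) (K.topHeight ν) := by
  refine ⟨convex_shadow, fun y hy y' hy' a b ha hb hab => ?_⟩
  have h := inner_le_topHeight (ν := ν)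
    (K.convex (topPoint_mem hν hy) (topPoint_mem hν hy') ha hb hab)
  rw [map_add, map_smul, map_smul, hyperplaneProj_topPoint, hyperplaneProj_topPoint,
    inner_add_left, inner_smul_left, inner_smul_left, inner_topPoint hν, inner_topPoint hν] at h
  simpa using h

/-- A point with an outer normal of positive `ν`-component is the highest point on its line. -/
theorem eq_topPoint (hν : ‖ν‖ = 1) {s n : E} (hn : n ∈ K.normals s) (hpos : 0 < ⟪n, ν⟫) :
    s = K.topPoint ν (hyperplaneProj ν s) := by
  obtain ⟨hs, hn1, hn2⟩ := hn
  have h1 := hn2 _ (topPoint_mem hν (hyperplaneProj_mem_shadow hs))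
  have h2 := inner_le_topHeight (ν := ν) hs
  rw [inner_eq_inner_hyperplaneProj_add hν, map_sub, hyperplaneProj_topPoint, sub_self,
    inner_zero_left, zero_add, inner_sub_left, inner_topPoint hν] at h1
  have h3 : K.topHeight ν (hyperplaneProj ν s) = ⟪s, ν⟫ := by nlinarith
  rw [topPoint_eq, h3, hyperplaneProj_add_inner_smul hν]

/-- Outer normals give supergradients of `topHeight`. -/
theorem topHeight_sub_mul_le (hν : ‖ν‖ = 1) {y y' : normalHyperplane ν} {n : E}
    (hn : n ∈ K.normals (K.topPoint ν y)) (hy' : y' ∈ K.shadow ν) :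
    (K.topHeight ν y' - K.topHeight ν y) * ⟪n, ν⟫ ≤ -⟪hyperplaneProj ν n, y' - y⟫ := by
  have h1 := hn.2.2 _ (topPoint_mem hν hy')
  rw [inner_eq_inner_hyperplaneProj_add hν, map_sub, hyperplaneProj_topPoint,
    hyperplaneProj_topPoint, inner_sub_left _ _ ν, inner_topPoint hν, inner_topPoint hν,
    real_inner_comm] at h1
  linarith

variable [FiniteDimensional ℝ E]

/-- The points of the interior of the shadow over which the upper boundary of `K` is smooth. -/
def regularSet (K : ConvexBody E) (ν : E) : Set (normalHyperplane ν) :=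
  {y | y ∈ interior (K.shadow ν) ∧ DifferentiableAt ℝ (K.topHeight ν) y}

/-- The slope of the upper boundary of `K`. -/
noncomputable def topSlope (K : ConvexBody E) (ν : E) (y : normalHyperplane ν) :
    normalHyperplane ν :=
  gradient (K.topHeight ν) y

/-- The unit outer normal of `K` at a regular point of the upper boundary. -/
noncomputable def topNormal (K : ConvexBody E) (ν : E) (y : normalHyperplane ν) : E :=
  ((areaDensity (K.topSlope ν y) : ℝ))⁻¹ • (ν - (K.topSlope ν y : E))

/-- By concavity each difference quotient along the segment from `y` to `y'` is at least the full
increment; the quotients tend to the derivative. -/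
theorem topHeight_sub_le (hν : ‖ν‖ = 1) {y y' : normalHyperplane ν} (hy : y ∈ K.regularSet ν)
    (hy' : y' ∈ K.shadow ν) :
    K.topHeight ν y' - K.topHeight ν y ≤ ⟪K.topSlope ν y, y' - y⟫ := by
  have hg : HasFDerivAt (K.topHeight ν) (InnerProductSpace.toDual ℝ _ (K.topSlope ν y)) y :=
    hy.2.hasGradientAt.hasFDerivAt
  have hline : HasDerivAt (fun t : ℝ => y + t • (y' - y)) (y' - y) 0 := by
    simpa using ((hasDerivAt_id (0 : ℝ)).smul_const (y' - y)).const_add y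
  have hg' : HasFDerivAt (K.topHeight ν) (InnerProductSpace.toDual ℝ _ (K.topSlope ν y))
    (y + (0 : ℝ) • (y' - y)) := by simpa using hg
  have hd := hg'.comp_hasDerivAt (0 : ℝ) hline
  rw [InnerProductSpace.toDual_apply_apply] at hd
  have ht := hd.tendsto_slope_zero_right
  refine ge_of_tendsto ht ?_
  have : Set.Ioc (0 : ℝ) 1 ∈ 𝓝[>] (0 : ℝ) := Ioc_mem_nhdsGT one_pos
  filter_upwards [this] with t ht
  have hc := (concaveOn_topHeight (K := K) hν).2 (interior_subset hy.1) hy'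
    (sub_nonneg.2 ht.2) ht.1.le (by ring)
  have e : (1 - t) • y + t • y' = y + t • (y' - y) := by rw [sub_smul, smul_sub, one_smul]; abel
  rw [e] at hc
  simp only [smul_eq_mul, Function.comp_apply, zero_add, zero_smul, add_zero] at hc ⊢
  rw [inv_mul_eq_div, le_div_iff₀ ht.1]
  linarith

/-- Subtracting the linear function of slope `b` leaves a local maximum at the interior point `y`,
where the derivative must vanish. -/
theorem eq_topSlope {y b : normalHyperplane ν} (hy : y ∈ K.regularSet ν)
    (hb : ∀ y' ∈ K.shadow ν, K.topHeight ν y' - K.topHeight ν y ≤ ⟪b, y' - y⟫) :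
    b = K.topSlope ν y := by
  have hg : HasFDerivAt (K.topHeight ν) (InnerProductSpace.toDual ℝ _ (K.topSlope ν y)) y :=
    hy.2.hasGradientAt.hasFDerivAt
  have hg2 : HasFDerivAt (fun y' => K.topHeight ν y' - InnerProductSpace.toDual ℝ _ b y')
    (InnerProductSpace.toDual ℝ _ (K.topSlope ν y) - InnerProductSpace.toDual ℝ _ b) y :=
    hg.sub (InnerProductSpace.toDual ℝ _ b).hasFDerivAt
  have hmax : IsLocalMax (fun y' => K.topHeight ν y' - InnerProductSpace.toDual ℝ _ b y') y := by
    filter_upwards [mem_interior_iff_mem_nhds.1 hy.1] with y' hy'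
    have := hb y' hy'
    rw [inner_sub_right] at this
    simp only [InnerProductSpace.toDual_apply_apply]
    linarith
  have h0 := hmax.hasFDerivAt_eq_zero hg2
  rw [← map_sub] at h0
  have := (InnerProductSpace.toDual ℝ (normalHyperplane ν)).injective (h0.trans (map_zero _).symm)
  exact (sub_eq_zero.1 this).symm

theorem areaDensity_pos (a : normalHyperplane ν) : (0 : ℝ) < areaDensity a := by
  have := one_le_areaDensity a
  exact_mod_cast zero_lt_one.trans_le this

theorem inner_topNormal (hν : ‖ν‖ = 1) (y : normalHyperplane ν) :
    ⟪K.topNormal ν y, ν⟫ = (areaDensity (K.topSlope ν y) : ℝ)⁻¹ := by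
  rw [topNormal, inner_smul_left, inner_sub_left, inner_coe_normalHyperplane,
    real_inner_self_eq_norm_sq, hν]
  simp

theorem hyperplaneProj_topNormal (y : normalHyperplane ν) :
    hyperplaneProj ν (K.topNormal ν y) =
      -((areaDensity (K.topSlope ν y) : ℝ)⁻¹ • K.topSlope ν y) := by
  rw [topNormal, map_smul, map_sub,
    Submodule.orthogonalProjectionOnto_orthogonalComplement_singleton_eq_zero,
    Submodule.orthogonalProjectionOnto_mem_subspace_eq_self, zero_sub, smul_neg]

theorem norm_topNormal (hν : ‖ν‖ = 1) (y : normalHyperplane ν) : ‖K.topNormal ν y‖ = 1 := by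
  have h : ‖K.topNormal ν y‖ ^ 2 = 1 := by
    rw [← real_inner_self_eq_norm_sq, inner_eq_inner_hyperplaneProj_add hν, inner_topNormal hν,
      hyperplaneProj_topNormal, inner_neg_neg, inner_smul_left, inner_smul_right,
      real_inner_self_eq_norm_sq]
    have hs := Real.sq_sqrt (show 0 ≤ 1 + ‖K.topSlope ν y‖ ^ 2 by positivity)
    rw [← coe_areaDensity] at hs
    have hp := areaDensity_pos (K.topSlope ν y)
    simp only [conj_trivial]
    field_simp
    linarith
  nlinarith [norm_nonneg (K.topNormal ν y)]

theorem topNormal_mem_normals (hν : ‖ν‖ = 1) {y : normalHyperplane ν}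
    (hy : y ∈ K.regularSet ν) : K.topNormal ν y ∈ K.normals (K.topPoint ν y) := by
  refine ⟨topPoint_mem hν (interior_subset hy.1), norm_topNormal hν y, fun z hz => ?_⟩
  have h1 := topHeight_sub_le hν hy (hyperplaneProj_mem_shadow hz)
  have h2 := inner_le_topHeight (ν := ν) hz
  rw [inner_eq_inner_hyperplaneProj_add hν, inner_topNormal hν, hyperplaneProj_topNormal, map_sub,
    hyperplaneProj_topPoint, inner_sub_left _ _ ν, inner_topPoint hν, inner_neg_right,
    inner_smul_right, real_inner_comm]
  have hp := inv_pos.2 (areaDensity_pos (K.topSlope ν y))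
  nlinarith

/-- Rescaled to `ν`-component 1, a normal encodes a supergradient, which is unique at a regular
point; the unit length then fixes the scale. -/
theorem eq_topNormal (hν : ‖ν‖ = 1) {y : normalHyperplane ν} (hy : y ∈ K.regularSet ν) {n : E}
    (hn : n ∈ K.normals (K.topPoint ν y)) (hpos : 0 < ⟪n, ν⟫) : n = K.topNormal ν y := by
  have hb : -(⟪n, ν⟫⁻¹ • hyperplaneProj ν n) = K.topSlope ν y := by
    refine eq_topSlope hy fun y' hy' => ?_
    have := topHeight_sub_mul_le hν hn hy'
    rw [inner_neg_left, inner_smul_left, ← mul_le_mul_iff_left₀ hpos]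
    simp only [conj_trivial]
    refine this.trans_eq ?_
    field_simp
  have hn' : n = ⟪n, ν⟫ • (ν - (K.topSlope ν y : E)) := by
    conv_lhs => rw [← hyperplaneProj_add_inner_smul hν n]
    rw [← hb, smul_sub]
    simp only [Submodule.coe_neg, Submodule.coe_smul, smul_neg, sub_neg_eq_add, smul_smul]
    rw [mul_inv_cancel₀ hpos.ne', one_smul, add_comm]
  have hcc : ⟪n, ν⟫ = (areaDensity (K.topSlope ν y) : ℝ)⁻¹ := by
    have h1 : ‖n‖ = ⟪n, ν⟫ * ‖ν - (K.topSlope ν y : E)‖ := by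
      conv_lhs => rw [hn']
      rw [norm_smul, Real.norm_of_nonneg hpos.le]
    have h2 : ‖K.topNormal ν y‖ = (areaDensity (K.topSlope ν y) : ℝ)⁻¹ *
        ‖ν - (K.topSlope ν y : E)‖ := by
      rw [topNormal, norm_smul, Real.norm_of_nonneg (inv_nonneg.2 (areaDensity_pos _).le)]
    rw [norm_topNormal hν] at h2
    rw [hn.2.1] at h1
    have h3 : ‖ν - (K.topSlope ν y : E)‖ ≠ 0 := by
      intro h0; rw [h0, mul_zero] at h2; exact one_ne_zero h2
    exact mul_right_cancel₀ h3 (h1.symm.trans h2)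
  rw [hn', topNormal, hcc]

variable [MeasurableSpace E] [BorelSpace E]

theorem measurableSet_regularSet : MeasurableSet (K.regularSet ν) :=
  measurableSet_interior.inter (measurableSet_of_differentiableAt ℝ _)

theorem measurable_topSlope : Measurable (K.topSlope ν) :=
  (InnerProductSpace.toDual ℝ (normalHyperplane ν)).symm.continuous.measurable.comp
    (measurable_fderiv ℝ _)

theorem measurable_topNormal : Measurable (K.topNormal ν) := by
  have h1 : Measurable fun y => (areaDensity (K.topSlope ν y) : ℝ) :=
    (measurable_areaDensity.comp measurable_topSlope).coe_nnreal_real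
  have h2 : Measurable fun y => (K.topSlope ν y : E) := measurable_topSlope.subtype_val
  exact h1.inv.smul (measurable_const.sub h2)

/-- The frontier of a convex set is null. In the interior a concave function is locally Lipschitz,
so Rademacher's theorem applies locally. -/
theorem ae_mem_regularSet (hν : ‖ν‖ = 1) :
    ∀ᵐ y : normalHyperplane ν, y ∈ K.shadow ν → y ∈ K.regularSet ν := by
  have h0 : volume (frontier (K.shadow ν)) = 0 :=
    Convex.addHaar_frontier volume (convex_shadow (K := K) (ν := ν))
  have h1 := measure_eq_zero_iff_ae_notMem.1 h0
  have h2 : volume {y : normalHyperplane ν | y ∈ interior (K.shadow ν) ∧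
      ¬ DifferentiableAt ℝ (K.topHeight ν) y} = 0 := by
    refine measure_null_of_locally_null _ fun y hy => ?_
    obtain ⟨C, t, ht, hl⟩ := (concaveOn_topHeight (K := K) hν).locallyLipschitzOn_interior hy.1
    rw [isOpen_interior.nhdsWithin_eq hy.1] at ht
    refine ⟨interior t ∩ {y | y ∈ interior (K.shadow ν) ∧ ¬ DifferentiableAt ℝ (K.topHeight ν) y},
      Filter.inter_mem (mem_nhdsWithin_of_mem_nhds (interior_mem_nhds.2 ht)) self_mem_nhdsWithin, ?_⟩
    rw [measure_eq_zero_iff_ae_notMem]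
    filter_upwards [hl.ae_differentiableWithinAt_of_mem (μ := volume)] with z hz hz'
    exact hz'.2.2 ((hz (interior_subset hz'.1)).differentiableAt (mem_interior_iff_mem_nhds.1 hz'.1))
  filter_upwards [h1, measure_eq_zero_iff_ae_notMem.1 h2] with y hy1 hy2 hy
  have hi : y ∈ interior (K.shadow ν) := by
    by_contra h
    exact hy1 ⟨subset_closure hy, h⟩
  refine ⟨hi, ?_⟩
  by_contra h
  exact hy2 ⟨hi, h⟩

theorem volume_shadow_diff_regularSet (hν : ‖ν‖ = 1) :
    volume (K.shadow ν \ K.regularSet ν) = 0 := by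
  rw [measure_eq_zero_iff_ae_notMem]
  filter_upwards [ae_mem_regularSet (K := K) hν] with y hy hy'
  exact hy'.2 (hy hy'.1)

theorem volume_regularSet_lt_top : volume (K.regularSet ν) < ∞ :=
  (measure_mono fun _ hy => interior_subset hy.1).trans_lt isCompact_shadow.measure_lt_top

/-- Almost every point with an outer normal of positive `ν`-component is regular. -/
theorem ae_mem_image_regularSet (hν : ‖ν‖ = 1) :
    ∀ᵐ s ∂(μHE[Module.finrank ℝ (normalHyperplane ν)] : Measure E),
      (∃ n ∈ K.normals s, 0 < ⟪n, ν⟫) → s ∈ K.topPoint ν '' K.regularSet ν := by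
  -- The upper boundary can become vertical, so `topPoint` need not be Lipschitz on the exceptional
  -- null set. Where some normal has `ν`-component at least `1 / (k + 1)`, the height is `(k +
  -- 1)`-Lipschitz and `topPoint` is `(k + 2)`-Lipschitz, so null sets have null images; these
  -- pieces exhaust the exceptional points.
  let B : ℕ → Set (normalHyperplane ν) := fun k => {y | y ∈ K.shadow ν \ K.regularSet ν ∧
    ∃ n ∈ K.normals (K.topPoint ν y), 1 ≤ (k + 1) * ⟪n, ν⟫}
  have hnull : ∀ k, μHE[Module.finrank ℝ (normalHyperplane ν)] (K.topPoint ν '' B k) = 0 := by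
    intro k
    have hone : ∀ y ∈ B k, ∀ y' ∈ B k,
        K.topHeight ν y' - K.topHeight ν y ≤ (k + 1) * ‖y - y'‖ := by
      rintro y ⟨hy, n, hn, hk⟩ y' ⟨hy', -⟩
      have h1 := topHeight_sub_mul_le hν hn hy'.1
      have h2 : -⟪hyperplaneProj ν n, y' - y⟫ ≤ ‖y - y'‖ := by
        rw [← inner_neg_right, neg_sub]
        refine (real_inner_le_norm _ _).trans ?_
        have := (normalHyperplane ν).norm_orthogonalProjectionOnto_apply_le n
        rw [hn.2.1] at this
        exact mul_le_of_le_one_left (norm_nonneg _) this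
      by_cases h3 : 0 ≤ K.topHeight ν y' - K.topHeight ν y
      · have hk' : (0 : ℝ) < k + 1 := by positivity
        nlinarith [norm_nonneg (y - y'), mul_le_mul_of_nonneg_left hk h3,
          mul_le_mul_of_nonneg_left (h1.trans h2) hk'.le]
      · have : (0 : ℝ) ≤ (k + 1) * ‖y - y'‖ := by positivity
        linarith
    have h := euclideanHausdorffMeasure_image_le_of_dist_le (F := K.topPoint ν)
      (G := (id : normalHyperplane ν → normalHyperplane ν)) (C := k + 2) (B := B k)
      (Module.finrank ℝ (normalHyperplane ν)) (by
        intro y hy y' hy'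
        have e : K.topPoint ν y - K.topPoint ν y' =
            ((y - y' : normalHyperplane ν) : E) + (K.topHeight ν y - K.topHeight ν y') • ν := by
          simp only [topPoint_eq, Submodule.coe_sub, sub_smul]; abel
        have h1 : |K.topHeight ν y - K.topHeight ν y'| ≤ (k + 1) * ‖y - y'‖ := by
          rw [abs_le]
          have h2 := hone y hy y' hy'
          have h3 := hone y' hy' y hy
          rw [norm_sub_rev] at h3
          constructor <;> linarith
        rw [dist_eq_norm, dist_eq_norm, id, id, e]
        refine (norm_add_le _ _).trans ?_
        rw [norm_smul, hν, mul_one, Real.norm_eq_abs, Submodule.coe_norm]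
        rw [Submodule.coe_norm] at h1
        push_cast at h1 ⊢
        linarith)
    rw [Set.image_id, InnerProductSpace.euclideanHausdorffMeasure_eq_volume,
      measure_mono_null (fun y hy => hy.1) (volume_shadow_diff_regularSet (K := K) hν),
      mul_zero] at h
    exact le_antisymm h zero_le
  have hU : ∀ᵐ s ∂(μHE[Module.finrank ℝ (normalHyperplane ν)] : Measure E),
      s ∉ ⋃ k, K.topPoint ν '' B k :=
    measure_eq_zero_iff_ae_notMem.1 (measure_iUnion_null hnull)
  filter_upwards [hU] with s hs
  rintro ⟨n, hn, hpos⟩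
  have hst := eq_topPoint hν hn hpos
  by_contra hreg
  apply hs
  obtain ⟨k, hk⟩ := exists_nat_gt (⟪n, ν⟫⁻¹)
  refine Set.mem_iUnion.2 ⟨k, hyperplaneProj ν s,
    ⟨⟨hyperplaneProj_mem_shadow hn.1, fun h => hreg ⟨_, h, hst.symm⟩⟩, n, by rwa [← hst], ?_⟩,
    hst.symm⟩
  have := mul_inv_cancel₀ hpos.ne'
  nlinarith

end ConvexBody

/-! ### Integration over the unit normal bundle -/

namespace ConvexBody

variable {E : Type*} [NormedAddCommGroup E] [InnerProductSpace ℝ E]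

/-- The set of unit outer normals of `K` at `s` with positive `ν`-component. -/
def upperNormals (K : ConvexBody E) (ν s : E) : Set E := {n | n ∈ K.normals s ∧ 0 < ⟪n, ν⟫}

/-- The sum of `f s n` over the unit outer normals `n` of `K` at `s`. -/
noncomputable def normalSum (K : ConvexBody E) (f : C(E × E, ℝ)) (s : E) : ℝ :=
  ∑ᶠ n ∈ K.normals s, f (s, n)

/-- The sum of `f s n * ⟨n, ν⟩` over the unit outer normals `n` of `K` at `s` with positive
`ν`-component. -/
noncomputable def upperSum (K : ConvexBody E) (ν : E) (f : C(E × E, ℝ)) (s : E) : ℝ :=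
  ∑ᶠ n ∈ K.upperNormals ν s, f (s, n) * ⟪n, ν⟫

/-- The function `(s, n) ↦ ⟨n, ν⟩`. -/
noncomputable def innerNormal (ν : E) : C(E × E, ℝ) := ⟨fun x => ⟪x.2, ν⟫, by fun_prop⟩

@[simp] theorem innerNormal_apply (ν : E) (x : E × E) : innerNormal ν x = ⟪x.2, ν⟫ := rfl

/-- The function `(s, n) ↦ max ⟨n, ν⟩ 0`. -/
noncomputable def innerNormalPos (ν : E) : C(E × E, ℝ) :=
  ⟨fun x => max ⟪x.2, ν⟫ 0, by fun_prop⟩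

@[simp] theorem innerNormalPos_apply (ν : E) (x : E × E) : innerNormalPos ν x = max ⟪x.2, ν⟫ 0 := rfl

variable {K : ConvexBody E} {ν : E}

variable [FiniteDimensional ℝ E]

theorem upperNormals_topPoint (hν : ‖ν‖ = 1) {y : normalHyperplane ν} (hy : y ∈ K.regularSet ν) :
    K.upperNormals ν (K.topPoint ν y) = {K.topNormal ν y} := by
  ext n
  constructor
  · rintro ⟨hn, hpos⟩
    exact eq_topNormal hν hy hn hpos
  · rintro rfl
    exact ⟨topNormal_mem_normals hν hy, by
      rw [inner_topNormal hν]; exact inv_pos.2 (areaDensity_pos _)⟩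

theorem topPoint_injective (hν : ‖ν‖ = 1) : Function.Injective (K.topPoint ν) :=
  graphMap_injective hν (inner_coe_normalHyperplane ν)

theorem continuousOn_topPoint (hν : ‖ν‖ = 1) : ContinuousOn (K.topPoint ν) (K.regularSet ν) := by
  have h := (concaveOn_topHeight (K := K) hν).continuousOn_interior.mono
    (fun y (hy : y ∈ K.regularSet ν) => hy.1)
  exact continuous_subtype_val.continuousOn.add (h.smul continuousOn_const)

/-- A bound for a continuous function on the unit normal bundles of all bodies in a ball. -/
theorem exists_bound_normalBundle (f : C(E × E, ℝ)) (R : ℝ) :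
    ∃ C, ∀ s n : E, ‖s‖ ≤ R → ‖n‖ ≤ 1 → ‖f (s, n)‖ ≤ C := by
  have hc : IsCompact (Metric.closedBall (0 : E) R ×ˢ Metric.closedBall (0 : E) 1) :=
    (isCompact_closedBall _ _).prod (isCompact_closedBall _ _)
  obtain ⟨C, hC⟩ := hc.exists_bound_of_continuousOn f.continuous.continuousOn
  exact ⟨C, fun s n hs hn => hC _ ⟨by simpa using hs, by simpa using hn⟩⟩

variable [MeasurableSpace E] [BorelSpace E]

theorem measurableSet_topPoint_image (hν : ‖ν‖ = 1) :
    MeasurableSet (K.topPoint ν '' K.regularSet ν) :=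
  measurableSet_regularSet.image_of_continuousOn_injOn (continuousOn_topPoint hν)
    (topPoint_injective hν).injOn

theorem aemeasurable_topPoint (hν : ‖ν‖ = 1) :
    AEMeasurable (K.topPoint ν) (volume.restrict (K.regularSet ν)) :=
  (continuousOn_topPoint hν).aemeasurable measurableSet_regularSet

/-- The area formula applied to every Borel part of the graph; the gradients of the concave height
serve as measurable supergradients. -/
theorem restrict_topPoint_image (hν : ‖ν‖ = 1) :
    (μHE[Module.finrank ℝ (normalHyperplane ν)] : Measure E).restrict
      (K.topPoint ν '' K.regularSet ν) =
    (((volume.restrict (K.regularSet ν)).withDensity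
      fun y => (areaDensity (K.topSlope ν y) : ℝ≥0∞)).map (K.topPoint ν)) := by
  ext A hA
  -- `topPoint` is known to be continuous only on the regular set, so measurability is obtained in
  -- the subtype.
  have hm : MeasurableSet (K.regularSet ν ∩ K.topPoint ν ⁻¹' A) := by
    obtain ⟨U, hU, hUeq⟩ := measurable_iff_comap_le.1
      (continuousOn_iff_continuous_domRestrict.1 (continuousOn_topPoint (K := K) hν)).measurable _
      ⟨A, hA, rfl⟩
    have : K.regularSet ν ∩ K.topPoint ν ⁻¹' A = K.regularSet ν ∩ U := by
      ext y
      constructor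
      · rintro ⟨h1, h2⟩
        refine ⟨h1, ?_⟩
        have : (⟨y, h1⟩ : K.regularSet ν) ∈ Subtype.val ⁻¹' U := by rw [hUeq]; exact h2
        exact this
      · rintro ⟨h1, h2⟩
        refine ⟨h1, ?_⟩
        have : (⟨y, h1⟩ : K.regularSet ν) ∈ (K.regularSet ν).domRestrict (K.topPoint ν) ⁻¹' A := by
          rw [← hUeq]; exact h2
        exact this
    rw [this]
    exact measurableSet_regularSet.inter hU
  have hpre : A ∩ K.topPoint ν '' K.regularSet ν =
      K.topPoint ν '' (K.regularSet ν ∩ K.topPoint ν ⁻¹' A) := by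
    rw [Set.image_inter_preimage, Set.inter_comm]
  rw [Measure.restrict_apply hA, hpre, Measure.map_apply_of_aemeasurable
    ((aemeasurable_topPoint hν).mono_ac (withDensity_absolutelyContinuous _ _)) hA]
  have hnull : NullMeasurableSet (K.topPoint ν ⁻¹' A) (volume.restrict (K.regularSet ν)) :=
    (aemeasurable_topPoint hν).nullMeasurable hA
  rw [withDensity_apply₀ _ hnull, Measure.restrict_restrict₀ hnull, Set.inter_comm]
  exact euclideanHausdorffMeasure_graphMap_image hν (inner_coe_normalHyperplane ν)
    (by rw [Set.inter_comm]; exact hm) measurable_topSlope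
    (fun y hy y' hy' => topHeight_sub_le hν hy.2 (interior_subset hy'.2.1))

/-- Almost every point with an upward normal lies over a regular point and has just one such normal,
so the sum has at most one term. -/
theorem upperSum_ae_eq (hν : ‖ν‖ = 1) (f : C(E × E, ℝ)) :
    K.upperSum ν f =ᵐ[μHE[Module.finrank ℝ (normalHyperplane ν)]]
      (K.topPoint ν '' K.regularSet ν).indicator fun s =>
        f (s, K.topNormal ν (hyperplaneProj ν s)) * ⟪K.topNormal ν (hyperplaneProj ν s), ν⟫ := by
  filter_upwards [ae_mem_image_regularSet (K := K) hν] with s hs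
  by_cases h : s ∈ K.topPoint ν '' K.regularSet ν
  · rw [Set.indicator_of_mem h]
    obtain ⟨y, hy, rfl⟩ := h
    rw [upperSum, upperNormals_topPoint hν hy, finsum_mem_singleton, hyperplaneProj_topPoint]
  · rw [Set.indicator_of_notMem h, upperSum]
    have : K.upperNormals ν s = ∅ := by
      rw [Set.eq_empty_iff_forall_notMem]
      exact fun n hn => h (hs ⟨n, hn⟩)
    rw [this, finsum_mem_empty]

theorem ae_upperNormals_subsingleton (hν : ‖ν‖ = 1) :
    ∀ᵐ s ∂(μHE[Module.finrank ℝ (normalHyperplane ν)] : Measure E),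
      (K.upperNormals ν s).Subsingleton := by
  filter_upwards [ae_mem_image_regularSet (K := K) hν] with s hs n hn n' hn'
  obtain ⟨y, hy, rfl⟩ := hs ⟨n, hn⟩
  rw [upperNormals_topPoint hν hy] at hn hn'
  exact hn.trans hn'.symm

theorem measurable_upperIntegrand (f : C(E × E, ℝ)) : Measurable fun s =>
    f (s, K.topNormal ν (hyperplaneProj ν s)) * ⟪K.topNormal ν (hyperplaneProj ν s), ν⟫ := by
  have h : Measurable fun s => K.topNormal ν (hyperplaneProj ν s) :=
    measurable_topNormal.comp (hyperplaneProj ν).continuous.measurable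
  have h2 : Measurable fun s : E => (s, K.topNormal ν (hyperplaneProj ν s)) :=
    measurable_id.prodMk h
  exact (f.continuous.measurable.comp h2).mul (h.inner measurable_const)

theorem aestronglyMeasurable_topPoint_topNormal (hν : ‖ν‖ = 1) (f : C(E × E, ℝ)) :
    AEStronglyMeasurable (fun y => f (K.topPoint ν y, K.topNormal ν y))
      (volume.restrict (K.regularSet ν)) :=
  (f.continuous.measurable.comp_aemeasurable
    ((aemeasurable_topPoint hν).prodMk measurable_topNormal.aemeasurable)).aestronglyMeasurable

theorem integrableOn_topPoint_topNormal (hν : ‖ν‖ = 1) (f : C(E × E, ℝ)) :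
    IntegrableOn (fun y => f (K.topPoint ν y, K.topNormal ν y)) (K.regularSet ν) := by
  obtain ⟨R, hR⟩ := K.isBounded.exists_norm_le
  obtain ⟨C, hC⟩ := exists_bound_normalBundle f R
  have : IsFiniteMeasure (volume.restrict (K.regularSet ν)) :=
    ⟨by simpa using volume_regularSet_lt_top⟩
  refine Integrable.of_bound (aestronglyMeasurable_topPoint_topNormal hν f) C ?_
  filter_upwards [ae_restrict_mem measurableSet_regularSet] with y hy
  exact hC _ _ (hR _ (topPoint_mem hν (interior_subset hy.1))) (norm_topNormal hν y).le

/-- The reason for the weight in `upperSum`: it is the reciprocal of the area density, so the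
Jacobian, which may be unbounded, cancels. -/
theorem areaDensity_smul_upperIntegrand (hν : ‖ν‖ = 1) (f : C(E × E, ℝ)) (y : normalHyperplane ν) :
    areaDensity (K.topSlope ν y) • (f (K.topPoint ν y,
      K.topNormal ν (hyperplaneProj ν (K.topPoint ν y))) *
        ⟪K.topNormal ν (hyperplaneProj ν (K.topPoint ν y)), ν⟫) =
    f (K.topPoint ν y, K.topNormal ν y) := by
  rw [hyperplaneProj_topPoint, inner_topNormal hν, NNReal.smul_def, smul_eq_mul]
  have := (areaDensity_pos (K.topSlope ν y)).ne'
  field_simp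

theorem measurable_areaDensity_topSlope : Measurable fun y => areaDensity (K.topSlope ν y) :=
  measurable_areaDensity.comp measurable_topSlope

/-- Integrals over the upper part of the boundary, in direction `ν`, are integrals over the
shadow. -/
theorem integrable_upperSum (hν : ‖ν‖ = 1) (f : C(E × E, ℝ)) :
    Integrable (K.upperSum ν f) μHE[Module.finrank ℝ (normalHyperplane ν)] := by
  rw [integrable_congr (upperSum_ae_eq hν f), integrable_indicator_iff
    (measurableSet_topPoint_image hν), IntegrableOn, restrict_topPoint_image hν,
    integrable_map_measure (measurable_upperIntegrand f).aestronglyMeasurable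
    ((aemeasurable_topPoint hν).mono_ac (withDensity_absolutelyContinuous _ _)),
    integrable_withDensity_iff_integrable_smul measurable_areaDensity_topSlope]
  refine (integrableOn_topPoint_topNormal hν f).congr (Filter.Eventually.of_forall fun y => ?_)
  exact (areaDensity_smul_upperIntegrand hν f y).symm

theorem integral_upperSum (hν : ‖ν‖ = 1) (f : C(E × E, ℝ)) :
    ∫ s, K.upperSum ν f s ∂μHE[Module.finrank ℝ (normalHyperplane ν)] =
      ∫ y in K.regularSet ν, f (K.topPoint ν y, K.topNormal ν y) := by
  rw [integral_congr_ae (upperSum_ae_eq hν f), integral_indicator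
    (measurableSet_topPoint_image hν), restrict_topPoint_image hν,
    integral_map ((aemeasurable_topPoint hν).mono_ac (withDensity_absolutelyContinuous _ _))
    (measurable_upperIntegrand f).aestronglyMeasurable,
    integral_withDensity_eq_integral_smul measurable_areaDensity_topSlope]
  exact integral_congr_ae (Filter.Eventually.of_forall fun y =>
    areaDensity_smul_upperIntegrand hν f y)

variable {m : ℕ}

theorem finrank_normalHyperplane (hm : Module.finrank ℝ E = m + 1) (hν : ‖ν‖ = 1) :
    Module.finrank ℝ (normalHyperplane ν) = m := by
  have : Fact (Module.finrank ℝ E = m + 1) := ⟨hm⟩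
  exact Submodule.finrank_orthogonal_span_singleton (by rintro rfl; simp at hν)

/-- Every unit vector has positive component along some `b i` or `-b i`, and almost everywhere each
of these finitely many directions sees at most one normal. Finiteness matters because `finsum` takes
the value 0 on infinite supports. -/
theorem ae_finite_normals (hm : Module.finrank ℝ E = m + 1) (K : ConvexBody E) :
    ∀ᵐ s ∂(μHE[m] : Measure E), (K.normals s).Finite := by
  let b := stdOrthonormalBasis ℝ E
  have hb : ∀ i, ‖b i‖ = 1 := b.orthonormal.1
  have h1 : ∀ i, ∀ᵐ s ∂(μHE[m] : Measure E), (K.upperNormals (b i) s).Subsingleton := fun i => by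
    have := ae_upperNormals_subsingleton (K := K) (hb i)
    rwa [finrank_normalHyperplane hm (hb i)] at this
  have h2 : ∀ i, ∀ᵐ s ∂(μHE[m] : Measure E), (K.upperNormals (-b i) s).Subsingleton := fun i => by
    have hb' : ‖-b i‖ = 1 := by rw [norm_neg, hb]
    have := ae_upperNormals_subsingleton (K := K) hb'
    rwa [finrank_normalHyperplane hm hb'] at this
  filter_upwards [ae_all_iff.2 h1, ae_all_iff.2 h2] with s hs1 hs2
  refine (Set.finite_iUnion fun i => (hs1 i).finite.union (hs2 i).finite).subset fun n hn => ?_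
  have : ∃ i, ⟪n, b i⟫ ≠ 0 := by
    by_contra! h
    have h0 := b.sum_sq_norm_inner_left n
    simp [h] at h0
    have hn1 := hn.2.1
    rw [hn1] at h0
    norm_num at h0
  obtain ⟨i, hi⟩ := this
  refine Set.mem_iUnion.2 ⟨i, ?_⟩
  rcases hi.lt_or_gt with h | h
  · exact Or.inr ⟨hn, by rw [inner_neg_right]; linarith⟩
  · exact Or.inl ⟨hn, h⟩

theorem upperSum_eq_sum {s : E} {S : Finset E} (hS : (S : Set E) = K.normals s) (ν : E)
    (f : C(E × E, ℝ)) :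
    K.upperSum ν f s = ∑ n ∈ S, if 0 < ⟪n, ν⟫ then f (s, n) * ⟪n, ν⟫ else 0 := by
  classical
  rw [← Finset.sum_filter, ← finsum_mem_coe_finset, upperSum]
  congr! 3 with n
  have : n ∈ K.normals s ↔ n ∈ S := by rw [← hS]; rfl
  simp [upperNormals, this]

theorem normalSum_eq_sum {s : E} {S : Finset E} (hS : (S : Set E) = K.normals s)
    (f : C(E × E, ℝ)) : K.normalSum f s = ∑ n ∈ S, f (s, n) := by
  rw [← finsum_mem_coe_finset, normalSum, hS]

theorem normalSum_mul_innerNormalPos {s : E} (hs : (K.normals s).Finite) (ν : E)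
    (f : C(E × E, ℝ)) : K.normalSum (f * innerNormalPos ν) s = K.upperSum ν f s := by
  obtain ⟨S, hS⟩ := hs.exists_finset_coe
  rw [upperSum_eq_sum hS, normalSum_eq_sum hS]
  refine Finset.sum_congr rfl fun n _ => ?_
  split_ifs with h
  · simp [max_eq_left h.le]
  · simp [max_eq_right (not_lt.1 h)]

/-- Multiply by `1 = ∑ ⟪n, b i⟫ ^ 2`. One factor of each square is the weight in `upperSum`, the
other is absorbed into `f`, and the sign of `⟪n, b i⟫` decides which of `b i` and `-b i` sees `n`.
-/
theorem normalSum_eq_sum_upperSum {ι : Type*} [Fintype ι] (b : OrthonormalBasis ι ℝ E) {s : E}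
    (hs : (K.normals s).Finite) (f : C(E × E, ℝ)) :
    K.normalSum f s = ∑ i, (K.upperSum (b i) (f * innerNormal (b i)) s +
      K.upperSum (-b i) (f * innerNormal (-b i)) s) := by
  obtain ⟨S, hS⟩ := hs.exists_finset_coe
  simp_rw [upperSum_eq_sum hS, normalSum_eq_sum hS, ← Finset.sum_add_distrib]
  rw [Finset.sum_comm]
  refine Finset.sum_congr rfl fun n hn => ?_
  have hn' : n ∈ K.normals s := by rw [← hS]; exact hn
  have h1 : ∑ i, ⟪n, b i⟫ ^ 2 = 1 := by
    have h0 := b.sum_sq_norm_inner_left n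
    rw [hn'.2.1] at h0
    simpa using h0
  have h2 : ∀ i, ((if 0 < ⟪n, b i⟫ then (f * innerNormal (b i)) (s, n) * ⟪n, b i⟫ else 0) +
      if 0 < ⟪n, -b i⟫ then (f * innerNormal (-b i)) (s, n) * ⟪n, -b i⟫ else 0) =
      f (s, n) * ⟪n, b i⟫ ^ 2 := by
    intro i
    simp only [inner_neg_right, ContinuousMap.mul_apply, innerNormal_apply, Left.neg_pos_iff]
    rcases lt_trichotomy ⟪n, b i⟫ 0 with h | h | h
    · rw [if_neg h.le.not_gt, if_pos h]; ring
    · simp [h]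
    · rw [if_pos h, if_neg h.le.not_gt]; ring
  rw [Finset.sum_congr rfl fun i _ => h2 i, ← Finset.mul_sum, h1, mul_one]

theorem integrable_upperSum' (hm : Module.finrank ℝ E = m + 1) (K : ConvexBody E) (hν : ‖ν‖ = 1)
    (f : C(E × E, ℝ)) : Integrable (K.upperSum ν f) μHE[m] := by
  have := integrable_upperSum (K := K) hν f
  rwa [finrank_normalHyperplane hm hν] at this

theorem integral_upperSum' (hm : Module.finrank ℝ E = m + 1) (K : ConvexBody E) (hν : ‖ν‖ = 1)
    (f : C(E × E, ℝ)) : ∫ s, K.upperSum ν f s ∂μHE[m] =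
      ∫ y in K.regularSet ν, f (K.topPoint ν y, K.topNormal ν y) := by
  have := integral_upperSum (K := K) hν f
  rwa [finrank_normalHyperplane hm hν] at this

theorem normalSum_ae_eq (hm : Module.finrank ℝ E = m + 1) (K : ConvexBody E)
    (f : C(E × E, ℝ)) : K.normalSum f =ᵐ[μHE[m]] fun s =>
      ∑ i, (K.upperSum (stdOrthonormalBasis ℝ E i) (f * innerNormal (stdOrthonormalBasis ℝ E i)) s +
      K.upperSum (-stdOrthonormalBasis ℝ E i) (f * innerNormal (-stdOrthonormalBasis ℝ E i)) s) := by
  filter_upwards [ae_finite_normals hm K] with s hs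
  exact normalSum_eq_sum_upperSum _ hs f

theorem integrable_normalSum (hm : Module.finrank ℝ E = m + 1) (K : ConvexBody E)
    (f : C(E × E, ℝ)) : Integrable (K.normalSum f) μHE[m] := by
  rw [integrable_congr (normalSum_ae_eq hm K f)]
  have hb : ∀ i, ‖stdOrthonormalBasis ℝ E i‖ = 1 := (stdOrthonormalBasis ℝ E).orthonormal.1
  exact integrable_finsetSum _ fun i _ => (integrable_upperSum' hm K (hb i) _).add
    (integrable_upperSum' hm K (by rw [norm_neg, hb]) _)

/-- The integral of `f` over the unit normal bundle of `K`, with respect to surface area. -/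
noncomputable def normalIntegral (m : ℕ) (K : ConvexBody E) (f : C(E × E, ℝ)) : ℝ :=
  ∫ s, K.normalSum f s ∂μHE[m]

theorem normalIntegral_eq (hm : Module.finrank ℝ E = m + 1) (K : ConvexBody E)
    (f : C(E × E, ℝ)) : K.normalIntegral m f =
      ∑ i, ((∫ y in K.regularSet (stdOrthonormalBasis ℝ E i),
        (f * innerNormal (stdOrthonormalBasis ℝ E i)) (K.topPoint (stdOrthonormalBasis ℝ E i) y,
          K.topNormal (stdOrthonormalBasis ℝ E i) y)) +
        ∫ y in K.regularSet (-stdOrthonormalBasis ℝ E i),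
        (f * innerNormal (-stdOrthonormalBasis ℝ E i)) (K.topPoint (-stdOrthonormalBasis ℝ E i) y,
          K.topNormal (-stdOrthonormalBasis ℝ E i) y)) := by
  have hb : ∀ i, ‖stdOrthonormalBasis ℝ E i‖ = 1 := (stdOrthonormalBasis ℝ E).orthonormal.1
  have hb' : ∀ i, ‖-stdOrthonormalBasis ℝ E i‖ = 1 := fun i => by rw [norm_neg, hb]
  rw [normalIntegral, integral_congr_ae (normalSum_ae_eq hm K f),
    integral_finsetSum]
  swap
  · exact fun i _ => (integrable_upperSum' hm K (hb i) _).add (integrable_upperSum' hm K (hb' i) _)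
  refine Finset.sum_congr rfl fun i _ => ?_
  rw [integral_add (integrable_upperSum' hm K (hb i) _) (integrable_upperSum' hm K (hb' i) _),
    integral_upperSum' hm K (hb i), integral_upperSum' hm K (hb' i)]

theorem normalIntegral_mul_innerNormalPos (hm : Module.finrank ℝ E = m + 1) (K : ConvexBody E)
    (hν : ‖ν‖ = 1) (f : C(E × E, ℝ)) : K.normalIntegral m (f * innerNormalPos ν) =
      ∫ y in K.regularSet ν, f (K.topPoint ν y, K.topNormal ν y) := by
  rw [← integral_upperSum' hm K hν, normalIntegral]
  refine integral_congr_ae ?_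
  filter_upwards [ae_finite_normals hm K] with s hs
  exact normalSum_mul_innerNormalPos hs ν f

end ConvexBody

/-! ### Continuity in the Hausdorff metric -/

namespace ConvexBody

open Filter

variable {E : Type*} [NormedAddCommGroup E] [InnerProductSpace ℝ E]

section Limits

variable {K L : ConvexBody E} {ν : E}

theorem exists_mem_dist_le {z : E} (hz : z ∈ L) (K : ConvexBody E) :
    ∃ z' ∈ K, dist z z' ≤ dist L K := by
  obtain ⟨z', hz', h⟩ := K.isCompact.exists_infDist_eq_dist K.nonempty z
  refine ⟨z', hz', ?_⟩
  rw [← h, ← hausdorffDist_coe]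
  exact Metric.infDist_le_hausdorffDist_of_mem hz hausdorffEDist_ne_top

/-- The unit normal bundle depends upper semicontinuously on the body. -/
theorem mem_normals_of_tendsto {α : Type*} {l : Filter α} [l.NeBot] {u : α → ConvexBody E}
    {σ η : α → E} {s n : E} (hu : Tendsto u l (𝓝 K)) (hσ : Tendsto σ l (𝓝 s))
    (hη : Tendsto η l (𝓝 n)) (h : ∀ᶠ j in l, η j ∈ (u j).normals (σ j)) : n ∈ K.normals s := by
  have hd : Tendsto (fun j => dist (u j) K) l (𝓝 0) := tendsto_iff_dist_tendsto_zero.1 hu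
  refine ⟨?_, ?_, fun y hy => ?_⟩
  · have h1 : Tendsto (fun j => Metric.infDist (σ j) (K : Set E)) l
        (𝓝 (Metric.infDist s (K : Set E))) :=
      (Metric.continuous_infDist_pt (K : Set E)).continuousAt.tendsto.comp hσ
    have h2 : Metric.infDist s (K : Set E) ≤ 0 := by
      refine le_of_tendsto_of_tendsto h1 hd ?_
      filter_upwards [h] with j hj
      rw [← hausdorffDist_coe]
      exact Metric.infDist_le_hausdorffDist_of_mem hj.1 hausdorffEDist_ne_top
    exact (K.isClosed.mem_iff_infDist_zero K.nonempty).2 (le_antisymm h2 Metric.infDist_nonneg)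
  · refine tendsto_nhds_unique hη.norm (tendsto_const_nhds.congr' ?_)
    filter_upwards [h] with j hj using hj.2.1.symm
  · have h1 : Tendsto (fun j => ⟪y - σ j, η j⟫) l (𝓝 ⟪y - s, n⟫) :=
      (tendsto_const_nhds.sub hσ).inner hη
    refine le_of_tendsto_of_tendsto h1 hd ?_
    filter_upwards [h] with j hj
    obtain ⟨y', hy', hyd⟩ := exists_mem_dist_le hy (u j)
    have h3 := hj.2.2 y' hy'
    have h4 : ⟪y - y', η j⟫ ≤ dist (u j) K := by
      refine (real_inner_le_norm _ _).trans ?_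
      rw [hj.2.1, mul_one, ← dist_eq_norm, dist_comm (u j)]
      exact hyd
    have h5 : y - σ j = (y - y') + (y' - σ j) := by abel
    rw [h5, inner_add_left]
    linarith

variable [FiniteDimensional ℝ E]

/-- If `y` were outside the shadow of `L`, with nearest point `w` there, going from `y` a distance
`r` directly away from `w` would reach a point of the shadow of `K` farther than `r` from that of
`L`. -/
theorem mem_shadow_of_dist_lt {y : normalHyperplane ν} {r : ℝ}
    (hr : Metric.closedBall y r ⊆ K.shadow ν) (hd : dist K L < r) : y ∈ L.shadow ν := by
  by_contra hy
  have hne : (L.shadow ν).Nonempty := L.nonempty.image _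
  obtain ⟨w, hw, hmin⟩ := exists_norm_eq_iInf_of_complete_convex hne
    (isCompact_shadow (K := L) (ν := ν)).isComplete convex_shadow y
  have hin := (norm_eq_iInf_iff_real_inner_le_zero (convex_shadow (K := L) (ν := ν)) hw).1 hmin
  have hpos : 0 < ‖y - w‖ := norm_pos_iff.2 (sub_ne_zero.2 fun h => hy (h ▸ hw))
  have hr0 : 0 ≤ r := dist_nonneg.trans hd.le
  have hmem : y + (r / ‖y - w‖) • (y - w) ∈ K.shadow ν := by
    apply hr
    rw [Metric.mem_closedBall, dist_self_add_left, norm_smul, norm_div, norm_norm,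
      div_mul_cancel₀ _ hpos.ne', Real.norm_of_nonneg hr0]
  obtain ⟨z, hz, hzy⟩ := hmem
  obtain ⟨z', hz', hzz⟩ := exists_mem_dist_le hz L
  have h1 := hin _ (hyperplaneProj_mem_shadow (ν := ν) hz')
  have h2 : ⟪hyperplaneProj ν z - hyperplaneProj ν z', y - w⟫ ≤ dist K L * ‖y - w‖ := by
    refine (real_inner_le_norm _ _).trans ?_
    gcongr
    rw [← map_sub]
    exact ((normalHyperplane ν).norm_orthogonalProjectionOnto_apply_le _).trans
      (by rw [← dist_eq_norm]; exact hzz)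
  have h3 : hyperplaneProj ν z - hyperplaneProj ν z' =
      (1 + r / ‖y - w‖) • (y - w) - (hyperplaneProj ν z' - w) := by
    rw [hzy, add_smul, one_smul]; abel
  rw [h3, inner_sub_left, inner_smul_left, real_inner_self_eq_norm_sq] at h2
  simp only [conj_trivial] at h2
  rw [real_inner_comm] at h1
  have h4 : (1 + r / ‖y - w‖) * ‖y - w‖ ^ 2 = ‖y - w‖ ^ 2 + r * ‖y - w‖ := by field_simp
  rw [h4] at h2
  nlinarith

/-- A normal orthogonal to `ν` would lie in the hyperplane; a small step along it stays in the
shadow, hence lifts to a point of `K` beyond the supporting hyperplane. -/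
theorem inner_ne_zero_of_mem_interior_shadow (hν : ‖ν‖ = 1) {s n : E} (hn : n ∈ K.normals s)
    (hs : hyperplaneProj ν s ∈ interior (K.shadow ν)) : ⟪n, ν⟫ ≠ 0 := by
  intro h0
  have hcont : Tendsto (fun t : ℝ => hyperplaneProj ν s + t • hyperplaneProj ν n) (𝓝[>] 0)
      (𝓝 (hyperplaneProj ν s)) := by
    refine tendsto_nhdsWithin_of_tendsto_nhds ?_
    have : Continuous fun t : ℝ => hyperplaneProj ν s + t • hyperplaneProj ν n := by fun_prop
    simpa using this.tendsto 0
  obtain ⟨t, ht, htpos⟩ := ((hcont.eventually (mem_interior_iff_mem_nhds.1 hs)).and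
    self_mem_nhdsWithin).exists
  obtain ⟨z, hz, hzt⟩ := ht
  have h1 := hn.2.2 z hz
  have h2 := inner_eq_inner_hyperplaneProj_add hν n n
  rw [real_inner_self_eq_norm_sq, hn.2.1, h0] at h2
  rw [inner_eq_inner_hyperplaneProj_add hν, map_sub, hzt, h0, add_sub_cancel_left,
    inner_smul_left] at h1
  simp only [conj_trivial] at h1
  have : (0 : ℝ) < t := htpos
  nlinarith

/-- By compactness it is enough to identify cluster points. Each is a point of `K` over `y` with a
normal of nonnegative `ν`-component, positive since `y` is interior to the shadow. Regularity at `y`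
then determines both. -/
theorem tendsto_topPoint_topNormal (hν : ‖ν‖ = 1) {u : ℕ → ConvexBody E}
    (hu : Tendsto u atTop (𝓝 K)) {R : ℝ} (hR : ∀ᶠ j in atTop, ∀ z ∈ u j, ‖z‖ ≤ R)
    {y : normalHyperplane ν} (hy : y ∈ K.regularSet ν)
    (hyu : ∀ᶠ j in atTop, y ∈ (u j).regularSet ν) :
    Tendsto (fun j => ((u j).topPoint ν y, (u j).topNormal ν y)) atTop
      (𝓝 (K.topPoint ν y, K.topNormal ν y)) := by
  have hc : IsCompact (Metric.closedBall (0 : E) R ×ˢ Metric.closedBall (0 : E) 1) :=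
    (isCompact_closedBall _ _).prod (isCompact_closedBall _ _)
  refine hc.tendsto_nhds_of_unique_mapClusterPt ?_ ?_
  · filter_upwards [hR, hyu] with j hj hyj
    exact ⟨by simpa using hj _ (topPoint_mem hν (interior_subset hyj.1)),
      by simpa using (norm_topNormal hν y).le⟩
  · rintro ⟨s, n⟩ - hcl
    obtain ⟨U, hU, hlim⟩ := mapClusterPt_iff_ultrafilter.1 hcl
    have hs : Tendsto (fun j => (u j).topPoint ν y) U (𝓝 s) := (continuous_fst.tendsto _).comp hlim
    have hn : Tendsto (fun j => (u j).topNormal ν y) U (𝓝 n) := (continuous_snd.tendsto _).comp hlim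
    have hmem : n ∈ K.normals s := mem_normals_of_tendsto (hu.mono_left hU) hs hn
      ((hyu.filter_mono hU).mono fun j hj => topNormal_mem_normals hν hj)
    have hproj : hyperplaneProj ν s = y := by
      refine tendsto_nhds_unique (((hyperplaneProj ν).continuous.tendsto s).comp hs) ?_
      exact tendsto_const_nhds.congr fun j => (hyperplaneProj_topPoint (K := u j) y).symm
    have hnonneg : 0 ≤ ⟪n, ν⟫ := by
      refine ge_of_tendsto (hn.inner tendsto_const_nhds) (Eventually.of_forall fun j => ?_)
      rw [inner_topNormal hν]
      exact inv_nonneg.2 (areaDensity_pos _).le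
    have hpos : 0 < ⟪n, ν⟫ := hnonneg.lt_of_ne
      (inner_ne_zero_of_mem_interior_shadow hν hmem (by rw [hproj]; exact hy.1)).symm
    have hst := eq_topPoint hν hmem hpos
    rw [hproj] at hst
    rw [hst] at hmem ⊢
    rw [eq_topNormal hν hy hmem hpos]

end Limits

variable [FiniteDimensional ℝ E] [MeasurableSpace E] [BorelSpace E] {ν : E}

theorem continuous_setIntegral_regularSet (hν : ‖ν‖ = 1) (f : C(E × E, ℝ)) :
    Continuous fun K : ConvexBody E =>
      ∫ y in K.regularSet ν, f (K.topPoint ν y, K.topNormal ν y) := by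
  rw [continuous_iff_continuousAt]
  intro K
  -- Restricting to sequences keeps the exceptional null sets of the bodies countable in number.
  refine tendsto_of_seq_tendsto fun u hu => ?_
  have hd : Tendsto (fun j => dist (u j) K) atTop (𝓝 0) := tendsto_iff_dist_tendsto_zero.1 hu
  obtain ⟨R, hR⟩ := K.isBounded.exists_norm_le
  have hRu : ∀ᶠ j in atTop, ∀ z ∈ u j, ‖z‖ ≤ R + 1 := by
    filter_upwards [hd.eventually (gt_mem_nhds one_pos)] with j hj z hz
    obtain ⟨z', hz', hzz⟩ := exists_mem_dist_le hz K
    have h1 := hR z' hz'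
    have h2 := norm_sub_norm_le z z'
    rw [← dist_eq_norm] at h2
    linarith
  obtain ⟨C, hC⟩ := exists_bound_normalBundle f (R + 1)
  simp only [← integral_indicator measurableSet_regularSet]
  refine tendsto_integral_filter_of_dominated_convergence
    ((Metric.closedBall (0 : normalHyperplane ν) (R + 1)).indicator fun _ => C) ?_ ?_ ?_ ?_
  · exact Eventually.of_forall fun j => (aestronglyMeasurable_indicator_iff
      measurableSet_regularSet).2 (aestronglyMeasurable_topPoint_topNormal hν f)
  · filter_upwards [hRu] with j hj
    refine Eventually.of_forall fun y => ?_
    by_cases hy : y ∈ (u j).regularSet ν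
    · have hmem := topPoint_mem hν (interior_subset hy.1)
      have hyR : y ∈ Metric.closedBall (0 : normalHyperplane ν) (R + 1) := by
        rw [mem_closedBall_zero_iff, ← hyperplaneProj_topPoint (K := u j) y]
        exact ((normalHyperplane ν).norm_orthogonalProjectionOnto_apply_le _).trans (hj _ hmem)
      rw [Set.indicator_of_mem hy, Set.indicator_of_mem hyR]
      exact hC _ _ (hj _ hmem) (norm_topNormal hν y).le
    · rw [Set.indicator_of_notMem hy, norm_zero]
      by_cases hyR : y ∈ Metric.closedBall (0 : normalHyperplane ν) (R + 1)
      · rw [Set.indicator_of_mem hyR]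
        obtain ⟨s, hs⟩ := K.nonempty
        exact (norm_nonneg _).trans (hC s 0 ((hR s hs).trans (by linarith)) (by simp))
      · rw [Set.indicator_of_notMem hyR]
  · exact (integrable_indicator_iff Metric.isClosed_closedBall.measurableSet).2
      (integrableOn_const (isCompact_closedBall _ _).measure_lt_top.ne)
  · filter_upwards [ae_mem_regularSet (K := K) hν,
      ae_all_iff.2 fun j => ae_mem_regularSet (K := u j) hν] with y hyK hyu
    by_cases hy : y ∈ K.shadow ν
    · have hreg := hyK hy
      obtain ⟨r, hr, hball⟩ := Metric.nhds_basis_closedBall.mem_iff.1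
        (mem_interior_iff_mem_nhds.1 hreg.1)
      have hyu' : ∀ᶠ j in atTop, y ∈ (u j).regularSet ν := by
        filter_upwards [hd.eventually (gt_mem_nhds hr)] with j hj
        exact hyu j (mem_shadow_of_dist_lt hball (by rwa [dist_comm]))
      rw [Set.indicator_of_mem hreg]
      refine ((f.continuous.tendsto _).comp
        (tendsto_topPoint_topNormal hν hu hRu hreg hyu')).congr' ?_
      filter_upwards [hyu'] with j hj
      rw [Set.indicator_of_mem hj]; rfl
    · have hy' : y ∉ K.regularSet ν := fun h => hy (interior_subset h.1)
      rw [Set.indicator_of_notMem hy']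
      have hpos : 0 < Metric.infDist y (K.shadow ν) :=
        (isCompact_shadow.isClosed.notMem_iff_infDist_pos (K.nonempty.image _)).1 hy
      refine tendsto_const_nhds.congr' ?_
      filter_upwards [hd.eventually (gt_mem_nhds hpos)] with j hj
      rw [Set.indicator_of_notMem]
      intro h
      obtain ⟨z', hz', hzz⟩ := exists_mem_dist_le (topPoint_mem hν (interior_subset h.1)) K
      have h1 := Metric.infDist_le_dist_of_mem (x := y) (hyperplaneProj_mem_shadow (ν := ν) hz')
      have h2 : dist y (hyperplaneProj ν z') ≤ dist ((u j).topPoint ν y) z' := by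
        conv_lhs => rw [← hyperplaneProj_topPoint (K := u j) y]
        rw [dist_eq_norm, dist_eq_norm, ← map_sub]
        exact (normalHyperplane ν).norm_orthogonalProjectionOnto_apply_le _
      linarith

/-- Integrals over the unit normal bundle depend continuously on the body. -/
theorem continuous_normalIntegral {m : ℕ} (hm : Module.finrank ℝ E = m + 1) (f : C(E × E, ℝ)) :
    Continuous fun K : ConvexBody E => K.normalIntegral m f := by
  have hb : ∀ i, ‖stdOrthonormalBasis ℝ E i‖ = 1 := (stdOrthonormalBasis ℝ E).orthonormal.1
  have hb' : ∀ i, ‖-stdOrthonormalBasis ℝ E i‖ = 1 := fun i => by rw [norm_neg, hb]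
  simp_rw [normalIntegral_eq hm]
  exact continuous_finsetSum _ fun i _ => (continuous_setIntegral_regularSet (hb i) _).add
    (continuous_setIntegral_regularSet (hb' i) _)

theorem volume_regularSet (hν : ‖ν‖ = 1) (K : ConvexBody E) :
    volume (K.regularSet ν) = volume (K.shadow ν) := by
  refine measure_congr (Filter.eventuallyEq_set.2 ?_)
  filter_upwards [ae_mem_regularSet (K := K) hν] with y hy
  exact ⟨fun h => interior_subset h.1, hy⟩

/-- The case `f = 1`: the surface area weighted by the positive part of `⟪n, ν⟫` is the volume of
the projection. -/
theorem normalIntegral_innerNormalPos {m : ℕ} (hm : Module.finrank ℝ E = m + 1) (K : ConvexBody E)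
    (hν : ‖ν‖ = 1) : K.normalIntegral m (innerNormalPos ν) = (volume (K.shadow ν)).toReal := by
  have h := normalIntegral_mul_innerNormalPos hm K hν 1
  rw [one_mul] at h
  rw [h]
  simp [Measure.real, volume_regularSet hν]

end ConvexBody

/-! ### Unions, isometries, translations and the vanishing normal sum -/

namespace ConvexBody

variable {E : Type*} [NormedAddCommGroup E] [InnerProductSpace ℝ E]

theorem exists_mem_segment_inter {K L : ConvexBody E} (h : Convex ℝ ((K : Set E) ∪ L)) {k l : E}
    (hk : k ∈ K) (hl : l ∈ L) : ∃ z ∈ segment ℝ k l, z ∈ K ∧ z ∈ L := by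
  have hc := isPreconnected_closed_iff.1 (convex_segment (𝕜 := ℝ) k l).isPreconnected (K : Set E) L
    K.isClosed L.isClosed (h.segment_subset (Or.inl hk) (Or.inr hl))
    ⟨k, left_mem_segment ℝ k l, hk⟩ ⟨l, right_mem_segment ℝ k l, hl⟩
  obtain ⟨z, hz, hzK, hzL⟩ := hc
  exact ⟨z, hz, hzK, hzL⟩

section Valuation

variable {K L : ConvexBody E} (h : Convex ℝ ((K : Set E) ∪ L)) (s : E)

/-- A normal of `K` at a point outside `L` is a normal of `K ∪ L`. -/
theorem inner_nonpos_of_notMem {K L : ConvexBody E} (h : Convex ℝ ((K : Set E) ∪ L)) {s n : E}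
    (hn : n ∈ K.normals s) (hs : s ∉ L) {l : E}
    (hl : l ∈ L) :
    ⟪l - s, n⟫ ≤ 0 := by
  obtain ⟨z, ⟨a, b, ha, hb, hab, rfl⟩, hzK, hzL⟩ := exists_mem_segment_inter h hn.1 hl
  have h1 := hn.2.2 _ hzK
  have h2 : a • s + b • l - s = b • (l - s) := by
    rw [← eq_sub_iff_add_eq] at hab
    rw [hab, sub_smul, one_smul, smul_sub]; abel
  rw [h2, inner_smul_left] at h1
  simp only [conj_trivial] at h1
  rcases hb.eq_or_lt with rfl | hb
  · rw [add_zero] at hab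
    rw [hab, one_smul, zero_smul, add_zero] at hzL
    exact absurd hzL hs
  · exact nonpos_of_mul_nonpos_right h1 hb

/-- The delicate case is a normal of `K ∩ L` at `s` that is normal to neither body: then some `k ∈
K` and `l ∈ L` lie strictly beyond the supporting hyperplane, and so does the whole segment between
them, which meets `K ∩ L` because `K ∪ L` is convex. -/
theorem normals_union_inter :
    (K.union L h).normals s ∪ (K.inter L h).normals s = K.normals s ∪ L.normals s := by
  have h' : Convex ℝ ((L : Set E) ∪ K) := by rwa [Set.union_comm]
  ext n
  constructor
  · rintro (⟨hs | hs, hn, hy⟩ | ⟨⟨hsK, hsL⟩, hn, hy⟩)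
    · exact Or.inl ⟨hs, hn, fun y hyK => hy y (Or.inl hyK)⟩
    · exact Or.inr ⟨hs, hn, fun y hyL => hy y (Or.inr hyL)⟩
    · by_contra hcon
      have hK : ∃ k ∈ K, 0 < ⟪k - s, n⟫ := by
        by_contra! hc
        exact hcon (Or.inl ⟨hsK, hn, hc⟩)
      have hL : ∃ l ∈ L, 0 < ⟪l - s, n⟫ := by
        by_contra! hc
        exact hcon (Or.inr ⟨hsL, hn, hc⟩)
      obtain ⟨k, hk, hkn⟩ := hK
      obtain ⟨l, hl, hln⟩ := hL
      obtain ⟨z, ⟨a, b, ha, hb, hab, rfl⟩, hz⟩ := exists_mem_segment_inter h hk hl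
      have h1 := hy _ hz
      have h2 : a • k + b • l - s = a • (k - s) + b • (l - s) := by
        rw [smul_sub, smul_sub]
        conv_lhs => rw [← one_smul ℝ s, ← hab, add_smul]
        abel
      rw [h2, inner_add_left, inner_smul_left, inner_smul_left] at h1
      simp only [conj_trivial] at h1
      rcases ha.eq_or_lt with rfl | ha
      · rw [zero_add] at hab; subst hab; linarith
      · nlinarith [mul_pos ha hkn, mul_nonneg hb hln.le]
  · rintro (hn | hn)
    · by_cases hs : s ∈ L
      · exact Or.inr ⟨⟨hn.1, hs⟩, hn.2.1, fun y hy => hn.2.2 y hy.1⟩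
      · exact Or.inl ⟨Or.inl hn.1, hn.2.1, fun y hy =>
          hy.elim (hn.2.2 y) (fun hy => inner_nonpos_of_notMem h hn hs hy)⟩
    · by_cases hs : s ∈ K
      · exact Or.inr ⟨⟨hs, hn.1⟩, hn.2.1, fun y hy => hn.2.2 y hy.2⟩
      · exact Or.inl ⟨Or.inr hn.1, hn.2.1, fun y hy =>
          hy.elim (fun hy => inner_nonpos_of_notMem h' hn hs hy) (hn.2.2 y)⟩

theorem normals_inter_union_inter :
    (K.union L h).normals s ∩ (K.inter L h).normals s = K.normals s ∩ L.normals s := by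
  ext n
  constructor
  · rintro ⟨hu, hi⟩
    exact ⟨⟨hi.1.1, hu.2.1, fun y hy => hu.2.2 y (Or.inl hy)⟩,
      ⟨hi.1.2, hu.2.1, fun y hy => hu.2.2 y (Or.inr hy)⟩⟩
  · rintro ⟨hK, hL⟩
    exact ⟨⟨Or.inl hK.1, hK.2.1, fun y hy => hy.elim (hK.2.2 y) (hL.2.2 y)⟩,
      ⟨⟨hK.1, hL.1⟩, hK.2.1, fun y hy => hK.2.2 y hy.1⟩⟩

end Valuation

section Normals

variable (K : ConvexBody E) (f : C(E × E, ℝ))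

theorem normals_mapIsometry (U : E ≃ₗᵢ[ℝ] E) (s : E) :
    (K.mapIsometry U).normals (U s) = U '' K.normals s := by
  ext n
  constructor
  · rintro ⟨⟨s', hs', hss⟩, hn, hy⟩
    rw [U.injective hss] at hs'
    refine ⟨U.symm n, ⟨hs', by simpa using hn, fun y hyK => ?_⟩, U.apply_symm_apply n⟩
    have := hy (U y) ⟨y, hyK, rfl⟩
    rw [← map_sub, ← U.apply_symm_apply n, U.inner_map_map] at this
    exact this
  · rintro ⟨n, ⟨hs, hn, hy⟩, rfl⟩
    refine ⟨⟨s, hs, rfl⟩, by simpa using hn, ?_⟩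
    rintro _ ⟨y, hyK, rfl⟩
    rw [← map_sub, U.inner_map_map]
    exact hy y hyK

theorem normalSum_mapIsometry (U : E ≃ₗᵢ[ℝ] E) (s : E) :
    (K.mapIsometry U).normalSum f (U s) =
      K.normalSum (f.comp ⟨fun x => (U x.1, U x.2), by fun_prop⟩) s := by
  rw [normalSum, normals_mapIsometry, finsum_mem_image U.injective.injOn]
  rfl

theorem normals_translate (x s : E) : (K.translate x).normals (s + x) = K.normals s := by
  ext n
  constructor
  · rintro ⟨⟨s', hs', hss⟩, hn, hy⟩
    rw [add_right_cancel hss] at hs'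
    refine ⟨hs', hn, fun y hyK => ?_⟩
    have := hy (y + x) ⟨y, hyK, rfl⟩
    rwa [add_sub_add_right_eq_sub] at this
  · rintro ⟨hs, hn, hy⟩
    refine ⟨⟨s, hs, rfl⟩, hn, ?_⟩
    rintro _ ⟨y, hyK, rfl⟩
    rw [add_sub_add_right_eq_sub]
    exact hy y hyK

theorem normalSum_translate (x s : E) :
    (K.translate x).normalSum f (s + x) =
      K.normalSum (f.comp ⟨fun y => (y.1 + x, y.2), by fun_prop⟩) s := by
  rw [normalSum, normals_translate]
  rfl

theorem mem_frontier_of_mem_normals {K : ConvexBody E} {s n : E} (hn : n ∈ K.normals s) :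
    s ∈ frontier (K : Set E) := by
  refine ⟨subset_closure hn.1, fun hint => ?_⟩
  have hcont : Filter.Tendsto (fun t : ℝ => s + t • n) (𝓝[>] 0) (𝓝 s) := by
    refine tendsto_nhdsWithin_of_tendsto_nhds ?_
    have : Continuous fun t : ℝ => s + t • n := by fun_prop
    simpa using this.tendsto 0
  obtain ⟨t, ht, htpos⟩ := ((hcont.eventually (mem_interior_iff_mem_nhds.1 hint)).and
    self_mem_nhdsWithin).exists
  have h1 := hn.2.2 _ ht
  rw [add_sub_cancel_left, inner_smul_left, real_inner_self_eq_norm_sq, hn.2.1] at h1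
  have : (0 : ℝ) < t := htpos
  simp at h1
  linarith

end Normals

variable [FiniteDimensional ℝ E] [MeasurableSpace E] [BorelSpace E] {m : ℕ}

theorem normalIntegral_mapIsometry (U : E ≃ₗᵢ[ℝ] E) (K : ConvexBody E) (f : C(E × E, ℝ)) :
    (K.mapIsometry U).normalIntegral m f =
      K.normalIntegral m (f.comp ⟨fun x => (U x.1, U x.2), by fun_prop⟩) := by
  have h := (U.toIsometryEquiv.measurePreserving_euclideanHausdorffMeasure m).integral_comp
    U.toIsometryEquiv.toHomeomorph.measurableEmbedding ((K.mapIsometry U).normalSum f)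
  rw [normalIntegral, ← h, normalIntegral]
  exact integral_congr_ae (Filter.Eventually.of_forall fun s => normalSum_mapIsometry K f U s)

theorem normalIntegral_translate (x : E) (K : ConvexBody E) (f : C(E × E, ℝ)) :
    (K.translate x).normalIntegral m f =
      K.normalIntegral m (f.comp ⟨fun y => (y.1 + x, y.2), by fun_prop⟩) := by
  have h := ((IsometryEquiv.addRight x).measurePreserving_euclideanHausdorffMeasure m).integral_comp
    (IsometryEquiv.addRight x).toHomeomorph.measurableEmbedding ((K.translate x).normalSum f)
  rw [normalIntegral, ← h, normalIntegral]
  exact integral_congr_ae (Filter.Eventually.of_forall fun s => normalSum_translate K f x s)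

/-- Inclusion and exclusion for the finite normal sets at almost every point. -/
theorem normalIntegral_union_add_inter (hm : Module.finrank ℝ E = m + 1) (K L : ConvexBody E)
    (h : Convex ℝ ((K : Set E) ∪ L)) (f : C(E × E, ℝ)) :
    (K.union L h).normalIntegral m f + (K.inter L h).normalIntegral m f =
      K.normalIntegral m f + L.normalIntegral m f := by
  simp only [normalIntegral]
  rw [← integral_add (integrable_normalSum hm _ f) (integrable_normalSum hm _ f),
    ← integral_add (integrable_normalSum hm _ f) (integrable_normalSum hm _ f)]
  refine integral_congr_ae ?_
  filter_upwards [ae_finite_normals hm K, ae_finite_normals hm L,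
    ae_finite_normals hm (K.union L h), ae_finite_normals hm (K.inter L h)] with s h1 h2 h3 h4
  simp only [normalSum]
  rw [← finsum_mem_union_inter h1 h2, ← finsum_mem_union_inter h3 h4, normals_union_inter,
    normals_inter_union_inter]

/-- Integration over the unit normal bundle, as a linear functional. -/
noncomputable def normalIntegralₗ (hm : Module.finrank ℝ E = m + 1) (K : ConvexBody E) :
    C(E × E, ℝ) →ₗ[ℝ] ℝ where
  toFun := K.normalIntegral m
  map_add' f g := by
    simp only [normalIntegral]
    rw [← integral_add (integrable_normalSum hm _ f) (integrable_normalSum hm _ g)]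
    refine integral_congr_ae ?_
    filter_upwards [ae_finite_normals hm K] with s hs
    obtain ⟨S, hS⟩ := hs.exists_finset_coe
    simp [normalSum_eq_sum hS, Finset.sum_add_distrib]
  map_smul' c f := by
    simp only [normalIntegral, RingHom.id_apply, smul_eq_mul]
    rw [← integral_const_mul]
    refine integral_congr_ae ?_
    filter_upwards [ae_finite_normals hm K] with s hs
    obtain ⟨S, hS⟩ := hs.exists_finset_coe
    simp [normalSum_eq_sum hS, Finset.mul_sum]

@[simp] theorem normalIntegralₗ_apply (hm : Module.finrank ℝ E = m + 1) (K : ConvexBody E)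
    (f : C(E × E, ℝ)) : K.normalIntegralₗ hm f = K.normalIntegral m f := rfl

theorem normalIntegral_mono (hm : Module.finrank ℝ E = m + 1) (K : ConvexBody E)
    {f g : C(E × E, ℝ)} (h : ∀ s, ∀ n ∈ K.normals s, f (s, n) ≤ g (s, n)) :
    K.normalIntegral m f ≤ K.normalIntegral m g := by
  refine integral_mono_ae (integrable_normalSum hm K f) (integrable_normalSum hm K g) ?_
  filter_upwards [ae_finite_normals hm K] with s hs
  obtain ⟨S, hS⟩ := hs.exists_finset_coe
  rw [normalSum_eq_sum hS, normalSum_eq_sum hS]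
  exact Finset.sum_le_sum fun n hn => h s n (by rw [← hS]; exact hn)

/-- The two shadows live in different types, so both volumes are expressed as Hausdorff measures of
one set in `E`. -/
theorem volume_shadow_neg (hm : Module.finrank ℝ E = m + 1) (K : ConvexBody E) {ν : E}
    (hν : ‖ν‖ = 1) : volume (K.shadow (-ν)) = volume (K.shadow ν) := by
  have key : ∀ ν : E, ‖ν‖ = 1 → volume (K.shadow ν) =
      μHE[m] ((fun z => z - ⟪z, ν⟫ • ν) '' (K : Set E)) := by
    intro ν hν
    have h1 : (fun z => z - ⟪z, ν⟫ • ν) '' (K : Set E) =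
        (normalHyperplane ν).subtypeₗᵢ '' K.shadow ν := by
      rw [shadow, Set.image_image]
      refine Set.image_congr fun z _ => ?_
      exact sub_eq_of_eq_add (hyperplaneProj_add_inner_smul hν z).symm
    rw [h1, (normalHyperplane ν).subtypeₗᵢ.isometry.euclideanHausdorffMeasure_image,
      ← InnerProductSpace.euclideanHausdorffMeasure_eq_volume, finrank_normalHyperplane hm hν]
  rw [key _ hν, key _ (by rwa [norm_neg])]
  simp

/-- The outer normals of a body, weighted by surface area, add up to zero. -/
theorem normalIntegral_innerNormal (hm : Module.finrank ℝ E = m + 1) (K : ConvexBody E) (v : E) :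
    K.normalIntegral m (innerNormal v) = 0 := by
  have unit : ∀ ν : E, ‖ν‖ = 1 → K.normalIntegral m (innerNormal ν) = 0 := by
    intro ν hν
    -- The positive and negative parts integrate to the volumes of the projections seen from `ν` and
    -- from `-ν`.
    have h1 : innerNormal ν = innerNormalPos ν - innerNormalPos (-ν) := by
      ext x
      simp only [innerNormal_apply, ContinuousMap.sub_apply, innerNormalPos_apply, inner_neg_right]
      rcases le_total ⟪x.2, ν⟫ 0 with h | h
      · rw [max_eq_right h, max_eq_left (by linarith)]; ring
      · rw [max_eq_left h, max_eq_right (by linarith)]; ring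
    rw [h1, ← normalIntegralₗ_apply hm, map_sub, normalIntegralₗ_apply, normalIntegralₗ_apply,
      normalIntegral_innerNormalPos hm K hν,
      normalIntegral_innerNormalPos hm K (by rwa [norm_neg]), volume_shadow_neg hm K hν, sub_self]
  rcases eq_or_ne v 0 with rfl | hv
  · have : innerNormal (0 : E) = 0 := by ext x; simp
    rw [this, ← normalIntegralₗ_apply hm, map_zero]
  · have : innerNormal v = ‖v‖ • innerNormal (‖v‖⁻¹ • v) := by
      ext x
      simp only [innerNormal_apply, ContinuousMap.smul_apply, inner_smul_right, smul_eq_mul]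
      have := norm_ne_zero_iff.2 hv
      field_simp
    rw [this, ← normalIntegralₗ_apply hm, map_smul, normalIntegralₗ_apply,
      unit _ (by simpa using norm_smul_inv_norm (𝕜 := ℝ) hv), smul_zero]

end ConvexBody

/-! ### Polynomials whose coefficients are continuous functions -/

section PolynomialFamilies

variable {Y : Type*} [TopologicalSpace Y]

/-- Apply a linear functional to the coefficients of a polynomial in several variables. -/
noncomputable def MvPolynomial.integrate {σ : Type*} (ℓ : C(Y, ℝ) →ₗ[ℝ] ℝ)
    (Q : MvPolynomial σ C(Y, ℝ)) : MvPolynomial σ ℝ :=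
  ∑ α ∈ Q.support, MvPolynomial.monomial α (ℓ (Q.coeff α))

theorem MvPolynomial.totalDegree_integrate_le {σ : Type*} (ℓ : C(Y, ℝ) →ₗ[ℝ] ℝ)
    (Q : MvPolynomial σ C(Y, ℝ)) : (Q.integrate ℓ).totalDegree ≤ Q.totalDegree :=
  MvPolynomial.totalDegree_finsetSum_le fun _ hα =>
    (MvPolynomial.totalDegree_monomial_le _ _).trans (MvPolynomial.le_totalDegree hα)

theorem map_mul_const (ℓ : C(Y, ℝ) →ₗ[ℝ] ℝ) (g : C(Y, ℝ)) (c : ℝ) :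
    ℓ (g * ContinuousMap.const Y c) = ℓ g * c := by
  have : g * ContinuousMap.const Y c = c • g := by ext; simp [mul_comm]
  rw [this, map_smul, smul_eq_mul, mul_comm]

theorem MvPolynomial.eval_integrate {σ : Type*} [Fintype σ] (ℓ : C(Y, ℝ) →ₗ[ℝ] ℝ)
    (Q : MvPolynomial σ C(Y, ℝ)) (x : σ → ℝ) :
    MvPolynomial.eval x (Q.integrate ℓ) =
      ℓ (MvPolynomial.eval (fun i => ContinuousMap.const Y (x i)) Q) := by
  rw [MvPolynomial.integrate, map_sum, MvPolynomial.eval_eq', map_sum]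
  refine Finset.sum_congr rfl fun α _ => ?_
  have : ∏ i, ContinuousMap.const Y (x i) ^ α i = ContinuousMap.const Y (∏ i, x i ^ α i) := by
    ext; simp
  rw [this, map_mul_const, MvPolynomial.eval_monomial, Finsupp.prod_fintype _ _ (by simp)]

/-- Apply a linear functional to the coefficients of a polynomial. -/
noncomputable def Polynomial.integrate (ℓ : C(Y, ℝ) →ₗ[ℝ] ℝ)
    (Q : Polynomial C(Y, ℝ)) : Polynomial ℝ :=
  ∑ k ∈ Q.support, Polynomial.monomial k (ℓ (Q.coeff k))

theorem Polynomial.coeff_integrate (ℓ : C(Y, ℝ) →ₗ[ℝ] ℝ) (Q : Polynomial C(Y, ℝ)) (k : ℕ) :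
    (Q.integrate ℓ).coeff k = ℓ (Q.coeff k) := by
  rw [Polynomial.integrate, Polynomial.finsetSum_coeff]
  simp only [Polynomial.coeff_monomial]
  rw [Finset.sum_ite_eq' Q.support k]
  split_ifs with h
  · rfl
  · rw [Polynomial.notMem_support_iff.1 h, map_zero]

theorem Polynomial.eval_integrate (ℓ : C(Y, ℝ) →ₗ[ℝ] ℝ) (Q : Polynomial C(Y, ℝ)) (r : ℝ) :
    (Q.integrate ℓ).eval r = ℓ (Q.eval (ContinuousMap.const Y r)) := by
  rw [Polynomial.integrate, Polynomial.eval_finsetSum, Polynomial.eval_eq_sum, Polynomial.sum,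
    map_sum]
  refine Finset.sum_congr rfl fun k _ => ?_
  have : ContinuousMap.const Y r ^ k = ContinuousMap.const Y (r ^ k) := by ext; simp
  rw [this, map_mul_const, Polynomial.eval_monomial]

/-- Restriction to a line through the origin does not raise the degree; this reduces lower bounds
for the degree to one variable. -/
theorem MvPolynomial.natDegree_aeval_line_le {σ : Type*} [Fintype σ] (P : MvPolynomial σ ℝ)
    (e : σ → ℝ) : (MvPolynomial.aeval
      (fun i => Polynomial.C (e i) * (Polynomial.X : Polynomial ℝ)) P).natDegree ≤
        P.totalDegree := by
  rw [MvPolynomial.aeval_def, MvPolynomial.eval₂_eq']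
  refine Polynomial.natDegree_sum_le_of_forall_le _ _ fun α hα => ?_
  refine (Polynomial.natDegree_C_mul_le _ _).trans ?_
  refine (Polynomial.natDegree_prod_le _ _).trans ?_
  refine le_trans ?_ (MvPolynomial.le_totalDegree hα)
  rw [Finsupp.sum_fintype _ _ (by simp)]
  refine Finset.sum_le_sum fun i _ => ?_
  refine Polynomial.natDegree_pow_le.trans ?_
  exact mul_le_of_le_one_right (Nat.zero_le _)
    ((Polynomial.natDegree_C_mul_le _ _).trans Polynomial.natDegree_X_le)

theorem MvPolynomial.eval_aeval_line {σ : Type*} (P : MvPolynomial σ ℝ)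
    (e : σ → ℝ) (r : ℝ) : (MvPolynomial.aeval
      (fun i => Polynomial.C (e i) * (Polynomial.X : Polynomial ℝ)) P).eval r =
        MvPolynomial.eval (fun i => r * e i) P := by
  have h : (Polynomial.aeval r).comp (MvPolynomial.aeval
      (fun i => Polynomial.C (e i) * (Polynomial.X : Polynomial ℝ))) =
        MvPolynomial.aeval (fun i => r * e i) := by
    refine MvPolynomial.algHom_ext fun i => ?_
    rw [AlgHom.comp_apply, MvPolynomial.aeval_X, MvPolynomial.aeval_X, map_mul,
      Polynomial.aeval_X, Polynomial.aeval_C]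
    exact mul_comm _ _
  rw [← Polynomial.coe_aeval_eq_eval, ← MvPolynomial.coe_aeval_eq_eval, ← h]
  rfl

end PolynomialFamilies

/-! ### The functional `xi` and upper bounds for its degree -/

namespace ConvexBody

variable {d m : ℕ}

section

variable {E : Type*} [NormedAddCommGroup E] [InnerProductSpace ℝ E]

/-- The function `(s, n) ↦ ⟨s, n⟩`. -/
noncomputable def innerPosNormal (E : Type*) [NormedAddCommGroup E] [InnerProductSpace ℝ E] :
    C(E × E, ℝ) := ⟨fun x => ⟪x.1, x.2⟫, by fun_prop⟩

/-- The function `(s, n) ↦ ⟨s, v⟩`. -/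
noncomputable def innerPos (v : E) : C(E × E, ℝ) := ⟨fun x => ⟪x.1, v⟫, by fun_prop⟩

/-- The function `(s, n) ↦ ‖s‖ ^ 2`. -/
noncomputable def normSqPos (E : Type*) [NormedAddCommGroup E] [InnerProductSpace ℝ E] :
    C(E × E, ℝ) := ⟨fun x => ‖x.1‖ ^ 2, by fun_prop⟩

@[simp] theorem innerPosNormal_apply (x : E × E) : innerPosNormal E x = ⟪x.1, x.2⟫ := rfl
@[simp] theorem innerPos_apply (v : E) (x : E × E) : innerPos v x = ⟪x.1, v⟫ := rfl
@[simp] theorem normSqPos_apply (x : E × E) : normSqPos E x = ‖x.1‖ ^ 2 := rfl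

/-- The integrand of `ξ_{p,q}` as a function of the point and the normal. -/
noncomputable def xiFun (E : Type*) [NormedAddCommGroup E] [InnerProductSpace ℝ E] (p q : ℕ) :
    C(E × E, ℝ) := innerPosNormal E ^ p * normSqPos E ^ q

/-- The map `(s, n) ↦ (s + x, n)`. -/
def shiftPos (x : E) : C(E × E, E × E) := ⟨fun y => (y.1 + x, y.2), by fun_prop⟩

theorem xiFun_apply (p q : ℕ) (x : E × E) : xiFun E p q x = ⟪x.1, x.2⟫ ^ p * ‖x.1‖ ^ (2 * q) := by
  simp [xiFun, pow_mul]

theorem xiFun_comp_shiftPos (p q : ℕ) (x : E) : (xiFun E p q).comp (shiftPos x) =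
    ((innerPosNormal E).comp (shiftPos x)) ^ p * ((normSqPos E).comp (shiftPos x)) ^ q := rfl

end

local notation "𝔼" => EuclideanSpace ℝ (Fin d)

/-- `normals` demands `s ∈ K`, and a normal at a point of `K` forces it onto the frontier, so the
domain of integration is built into the sum. -/
theorem normalSum_xiFun (p q : ℕ) (K : ConvexBody 𝔼) :
    K.normalSum (xiFun 𝔼 p q) = (frontier (K : Set 𝔼)).indicator (xiIntegrand p q K) := by
  ext s
  by_cases hs : s ∈ frontier (K : Set 𝔼)
  · rw [Set.indicator_of_mem hs, normalSum, xiIntegrand]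
    have hsK : s ∈ K := K.isClosed.frontier_subset hs
    have : K.normals s = K.unitOuterNormals s := by
      ext n; simp [normals, unitOuterNormals, hsK]
    rw [this]
    simp only [xiFun_apply]
  · rw [Set.indicator_of_notMem hs, normalSum]
    have : K.normals s = ∅ := Set.eq_empty_iff_forall_notMem.2 fun n hn =>
      hs (mem_frontier_of_mem_normals hn)
    rw [this, finsum_mem_empty]

theorem xi_eq_normalIntegral (p q : ℕ) (K : ConvexBody 𝔼) :
    xi p q K = K.normalIntegral (d - 1) (xiFun 𝔼 p q) := by
  rw [xi, normalIntegral, normalSum_xiFun, integral_indicator isClosed_frontier.measurableSet]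

theorem integrableOn_xiIntegrand (hm : Module.finrank ℝ 𝔼 = d - 1 + 1) (p q : ℕ)
    (K : ConvexBody 𝔼) :
    IntegrableOn (xiIntegrand p q K) (frontier (K : Set 𝔼)) μHE[d - 1] := by
  rw [← integrable_indicator_iff isClosed_frontier.measurableSet, ← normalSum_xiFun]
  exact integrable_normalSum hm K _

theorem isOrthogonalInvariant_xi (p q : ℕ) :
    IsOrthogonalInvariant (xi p q : ConvexBody 𝔼 → ℝ) := by
  intro U K
  rw [xi_eq_normalIntegral, xi_eq_normalIntegral, normalIntegral_mapIsometry]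
  congr 1
  ext x
  simp [xiFun_apply]

theorem continuous_xi (hm : Module.finrank ℝ 𝔼 = d - 1 + 1) (p q : ℕ) :
    Continuous (xi p q : ConvexBody 𝔼 → ℝ) := by
  have : (xi p q : ConvexBody 𝔼 → ℝ) = fun K => K.normalIntegral (d - 1) (xiFun 𝔼 p q) :=
    funext (xi_eq_normalIntegral p q)
  rw [this]
  exact continuous_normalIntegral hm _

theorem isValuation_xi (hm : Module.finrank ℝ 𝔼 = d - 1 + 1) (p q : ℕ) :
    IsValuation (xi p q : ConvexBody 𝔼 → ℝ) := by
  intro K L h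
  simp only [xi_eq_normalIntegral]
  exact normalIntegral_union_add_inter hm K L h _

theorem xi_translate (p q : ℕ) (K : ConvexBody 𝔼) (x : 𝔼) :
    xi p q (K.translate x) = K.normalIntegral (d - 1) ((xiFun 𝔼 p q).comp (shiftPos x)) := by
  rw [xi_eq_normalIntegral, normalIntegral_translate]
  rfl

section UpperDegree

open MvPolynomial

/-- `⟨x, n⟩` as a polynomial in `x`. -/
noncomputable def normalPoly (d : ℕ) :
    MvPolynomial (Fin d) C(EuclideanSpace ℝ (Fin d) × EuclideanSpace ℝ (Fin d), ℝ) :=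
  ∑ i, C (innerNormal (EuclideanSpace.single i 1)) * X i

/-- `‖x‖ ^ 2` as a polynomial in `x`. -/
noncomputable def sqPoly (d : ℕ) :
    MvPolynomial (Fin d) C(EuclideanSpace ℝ (Fin d) × EuclideanSpace ℝ (Fin d), ℝ) :=
  ∑ i, X i ^ 2

/-- `‖s‖ ^ 2 + 2 * ⟨s, x⟩` as a polynomial in `x`. -/
noncomputable def crossPoly (d : ℕ) :
    MvPolynomial (Fin d) C(EuclideanSpace ℝ (Fin d) × EuclideanSpace ℝ (Fin d), ℝ) :=
  C (normSqPos (EuclideanSpace ℝ (Fin d))) +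
    ∑ i, C (2 * innerPos (EuclideanSpace.single i 1)) * X i

theorem totalDegree_sum_C_mul_X_le {R : Type*} [CommRing R] [Nontrivial R] (c : Fin d → R) :
    (∑ i, C (c i) * X i : MvPolynomial (Fin d) R).totalDegree ≤ 1 :=
  totalDegree_finsetSum_le fun i _ => (totalDegree_mul _ _).trans (by
    rw [totalDegree_C, totalDegree_X])

theorem totalDegree_normalPoly_le : (normalPoly d).totalDegree ≤ 1 := totalDegree_sum_C_mul_X_le _

theorem totalDegree_sqPoly_le : (sqPoly d).totalDegree ≤ 2 :=
  totalDegree_finsetSum_le fun i _ => by rw [totalDegree_X_pow]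

theorem totalDegree_crossPoly_le : (crossPoly d).totalDegree ≤ 1 :=
  (totalDegree_add _ _).trans (max_le (by rw [totalDegree_C]; exact Nat.zero_le _)
    (totalDegree_sum_C_mul_X_le _))

theorem totalDegree_crossPoly_add_sqPoly_le : (crossPoly d + sqPoly d).totalDegree ≤ 2 :=
  (totalDegree_add _ _).trans (max_le (totalDegree_crossPoly_le.trans one_le_two)
    totalDegree_sqPoly_le)

theorem eval_normalPoly (x : 𝔼) :
    eval (fun i => ContinuousMap.const _ (x i)) (normalPoly d) = innerNormal x := by
  ext y
  simp [normalPoly, map_sum, PiLp.inner_apply, mul_comm]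

theorem eval_sqPoly (x : 𝔼) :
    eval (fun i => ContinuousMap.const _ (x i)) (sqPoly d) = ContinuousMap.const _ (‖x‖ ^ 2) := by
  ext y
  simp [sqPoly, EuclideanSpace.norm_sq_eq]

theorem eval_crossPoly (x : 𝔼) :
    eval (fun i => ContinuousMap.const _ (x i)) (crossPoly d) = normSqPos 𝔼 + 2 * innerPos x := by
  ext y
  simp only [crossPoly, map_add, map_sum, map_mul, eval_C, eval_X, ContinuousMap.add_apply,
    ContinuousMap.mul_apply, ContinuousMap.coe_sum, Finset.sum_apply, ContinuousMap.const_apply,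
    innerPos_apply, PiLp.inner_apply, Finset.mul_sum]
  congr 1
  refine Finset.sum_congr rfl fun i _ => ?_
  simp
  ring

theorem innerPosNormal_comp_shiftPos (x : 𝔼) :
    (innerPosNormal 𝔼).comp (shiftPos x) = innerPosNormal 𝔼 + innerNormal x := by
  ext y
  simp [shiftPos, inner_add_left, real_inner_comm]

theorem normSqPos_comp_shiftPos (x : 𝔼) :
    (normSqPos 𝔼).comp (shiftPos x) =
      normSqPos 𝔼 + 2 * innerPos x + ContinuousMap.const _ (‖x‖ ^ 2) := by
  ext y
  simp only [shiftPos, ContinuousMap.comp_apply, ContinuousMap.coe_mk, normSqPos_apply,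
    norm_add_sq_real, ContinuousMap.add_apply, ContinuousMap.const_apply]
  rfl

theorem isPolynomialOfDegreeLE_xi (hm : Module.finrank ℝ 𝔼 = d - 1 + 1) (p q : ℕ) :
    IsPolynomialOfDegreeLE (xi p q : ConvexBody 𝔼 → ℝ) (p + 2 * q) := by
  intro K
  refine ⟨((C (innerPosNormal 𝔼) + normalPoly d) ^ p * (crossPoly d + sqPoly d) ^ q).integrate
    (K.normalIntegralₗ hm), ?_, fun x => ?_⟩
  · refine (totalDegree_integrate_le _ _).trans ((totalDegree_mul _ _).trans ?_)
    refine add_le_add ((totalDegree_pow _ _).trans ?_) ((totalDegree_pow _ _).trans ?_)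
    · refine mul_le_of_le_one_right (Nat.zero_le _) ((totalDegree_add _ _).trans (max_le ?_
        totalDegree_normalPoly_le))
      rw [totalDegree_C]; exact Nat.zero_le _
    · rw [mul_comm 2]
      exact Nat.mul_le_mul_left _ totalDegree_crossPoly_add_sqPoly_le
  · rw [xi_translate, eval_integrate, normalIntegralₗ_apply, xiFun_comp_shiftPos,
      innerPosNormal_comp_shiftPos, normSqPos_comp_shiftPos]
    simp only [map_mul, map_pow, map_add, eval_C, eval_normalPoly, eval_sqPoly, eval_crossPoly]

/-- The difference of powers is divisible by `crossPoly d`, of degree at most 1, with a cofactor of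
degree at most `2 * (q - 1)`; together with `normalPoly d` this makes `2 * q`. -/
theorem totalDegree_pow_sub_pow_le (q : ℕ) :
    (normalPoly d * ((crossPoly d + sqPoly d) ^ q - sqPoly d ^ q)).totalDegree ≤ 2 * q := by
  rcases q with _ | q
  · simp
  rw [← geom_sum₂_mul, add_sub_cancel_right]
  refine (totalDegree_mul _ _).trans ?_
  have h1 : (∑ i ∈ Finset.range (q + 1),
      (crossPoly d + sqPoly d) ^ i * sqPoly d ^ (q + 1 - 1 - i)).totalDegree ≤ 2 * q := by
    refine totalDegree_finsetSum_le fun i hi => (totalDegree_mul _ _).trans ?_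
    have h2 := (totalDegree_pow (crossPoly d + sqPoly d) i).trans
      (Nat.mul_le_mul_left _ totalDegree_crossPoly_add_sqPoly_le)
    have h3 := (totalDegree_pow (sqPoly d) (q + 1 - 1 - i)).trans
      (Nat.mul_le_mul_left _ totalDegree_sqPoly_le)
    have := Finset.mem_range.1 hi
    omega
  have h4 := totalDegree_mul (∑ i ∈ Finset.range (q + 1),
      (crossPoly d + sqPoly d) ^ i * sqPoly d ^ (q + 1 - 1 - i)) (crossPoly d)
  have h5 := totalDegree_normalPoly_le (d := d)
  have h6 := totalDegree_crossPoly_le (d := d)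
  omega

/-- The witness is the expanded integrand without `⟪x, n⟫ * ‖x‖ ^ (2 * q)`, which contributes
nothing because the area-weighted normals sum to zero. -/
theorem isPolynomialOfDegreeLE_xi_one (hm : Module.finrank ℝ 𝔼 = d - 1 + 1) (q : ℕ) :
    IsPolynomialOfDegreeLE (xi 1 q : ConvexBody 𝔼 → ℝ) (2 * q) := by
  intro K
  refine ⟨(C (innerPosNormal 𝔼) * (crossPoly d + sqPoly d) ^ q +
    normalPoly d * ((crossPoly d + sqPoly d) ^ q - sqPoly d ^ q)).integrate
    (K.normalIntegralₗ hm), ?_, fun x => ?_⟩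
  · refine (totalDegree_integrate_le _ _).trans ((totalDegree_add _ _).trans (max_le ?_
      (totalDegree_pow_sub_pow_le q)))
    refine (totalDegree_mul _ _).trans ?_
    rw [totalDegree_C, zero_add, mul_comm 2]
    exact (totalDegree_pow _ _).trans
      (Nat.mul_le_mul_left _ totalDegree_crossPoly_add_sqPoly_le)
  · rw [xi_translate, eval_integrate, ← normalIntegralₗ_apply hm, xiFun_comp_shiftPos,
      innerPosNormal_comp_shiftPos, normSqPos_comp_shiftPos]
    simp only [map_mul, map_pow, map_add, map_sub, eval_C, eval_normalPoly, eval_sqPoly,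
      eval_crossPoly]
    set B := normSqPos 𝔼 + 2 * innerPos x + ContinuousMap.const _ (‖x‖ ^ 2)
    have h1 : ContinuousMap.const (𝔼 × 𝔼) (‖x‖ ^ 2) ^ q =
        ContinuousMap.const _ ((‖x‖ ^ 2) ^ q) := by ext; simp
    have h2 : (innerPosNormal 𝔼 + innerNormal x) ^ 1 * B ^ q =
        innerPosNormal 𝔼 * B ^ q + innerNormal x * (B ^ q - ContinuousMap.const _ (‖x‖ ^ 2) ^ q) +
          innerNormal x * ContinuousMap.const _ ((‖x‖ ^ 2) ^ q) := by
      rw [h1]; ring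
    rw [h2, ← map_add, map_add _ (_ + _) (innerNormal x * _), map_mul_const,
      normalIntegralₗ_apply hm K (innerNormal x), normalIntegral_innerNormal hm, zero_mul,
      add_zero]

end UpperDegree

end ConvexBody

/-! ### Sharpness of the degree: half ball and unit ball -/

namespace ConvexBody

section LowerDegree

open Polynomial

variable {E : Type*} [NormedAddCommGroup E] [InnerProductSpace ℝ E]

/-- The inner product of `s + r e` with `n`, as a polynomial in `r`. -/
noncomputable def lineInner (e : E) : C(E × E, ℝ)[X] := C (innerPosNormal E) + C (innerNormal e) * X

/-- The squared norm of `s + r e`, as a polynomial in `r`, when `e` is a unit vector. -/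
noncomputable def lineNormSq (e : E) : C(E × E, ℝ)[X] :=
  X ^ 2 + C (2 * innerPos e) * X + C (normSqPos E)

theorem monic_lineNormSq (e : E) : (lineNormSq e).Monic := by
  unfold lineNormSq; monicity!

theorem natDegree_lineNormSq (e : E) : (lineNormSq e).natDegree = 2 := by
  unfold lineNormSq; compute_degree!

theorem nextCoeff_lineNormSq (e : E) : (lineNormSq e).nextCoeff = 2 * innerPos e := by
  rw [nextCoeff_of_natDegree_pos (by rw [natDegree_lineNormSq]; norm_num), natDegree_lineNormSq]
  simp [lineNormSq, coeff_X_pow, coeff_C]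

theorem natDegree_lineInner_le (e : E) : (lineInner e).natDegree ≤ 1 := by
  unfold lineInner; compute_degree

theorem coeff_top_line (e : E) (p q : ℕ) :
    (lineInner e ^ p * lineNormSq e ^ q).coeff (p + 2 * q) = innerNormal e ^ p := by
  have hA : (lineInner e ^ p).natDegree ≤ p := by
    simpa using natDegree_pow_le_of_le p (natDegree_lineInner_le e)
  have hB : (lineNormSq e ^ q).natDegree ≤ 2 * q := by
    rw [mul_comm]; exact natDegree_pow_le_of_le q (natDegree_lineNormSq e).le
  rw [coeff_mul_add_eq_of_natDegree_le hA hB]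
  have h1 : (lineInner e ^ p).coeff p = innerNormal e ^ p := by
    have := coeff_pow_of_natDegree_le (m := p) (natDegree_lineInner_le e)
    rw [mul_one] at this
    rw [this]
    simp [lineInner, coeff_C]
  have h2 : (lineNormSq e ^ q).coeff (2 * q) = 1 := by
    have h := (monic_lineNormSq e).pow q
    have hd := (monic_lineNormSq e).natDegree_pow q
    rw [natDegree_lineNormSq, mul_comm] at hd
    rw [← hd]
    exact h.coeff_natDegree
  rw [h1, h2, mul_one]

/-- One below the top degree there are two contributions: the constant term of `lineInner e` with
the leading coefficient 1, and its linear term with the next coefficient of the monic power. -/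
theorem coeff_line_one (e : E) {q : ℕ} (hq : q ≠ 0) :
    (lineInner e ^ 1 * lineNormSq e ^ q).coeff (2 * q) =
      innerPosNormal E + innerNormal e * (q • (2 * innerPos e)) := by
  have hd := (monic_lineNormSq e).natDegree_pow q
  rw [natDegree_lineNormSq, mul_comm] at hd
  have h1 : (lineNormSq e ^ q).coeff (2 * q) = 1 := by
    rw [← hd]; exact ((monic_lineNormSq e).pow q).coeff_natDegree
  have h2 : (lineNormSq e ^ q).coeff (2 * q - 1) = q • (2 * innerPos e) := by
    rw [← nextCoeff_lineNormSq, ← (monic_lineNormSq e).nextCoeff_pow,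
      nextCoeff_of_natDegree_pos (by rw [hd]; omega), hd]
  have h3 : 2 * q = (2 * q - 1) + 1 := by omega
  rw [pow_one, lineInner, add_mul, coeff_add, coeff_C_mul, h1, mul_one, mul_assoc, coeff_C_mul]
  conv_lhs => rw [h3]
  rw [coeff_X_mul, h2]

end LowerDegree

variable {d : ℕ}

local notation "𝔼" => EuclideanSpace ℝ (Fin d)

theorem eval_line (p q : ℕ) {e : 𝔼} (he : ‖e‖ = 1) (r : ℝ) :
    (lineInner e ^ p * lineNormSq e ^ q).eval (ContinuousMap.const _ r) =
      (xiFun 𝔼 p q).comp (shiftPos (r • e)) := by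
  rw [xiFun_comp_shiftPos, innerPosNormal_comp_shiftPos, normSqPos_comp_shiftPos,
    Polynomial.eval_mul, Polynomial.eval_pow, Polynomial.eval_pow]
  congr 2
  · ext y
    simp only [lineInner, Polynomial.eval_add, Polynomial.eval_mul, Polynomial.eval_C,
      Polynomial.eval_X, ContinuousMap.add_apply, ContinuousMap.mul_apply,
      ContinuousMap.const_apply, innerNormal_apply, inner_smul_right]
    ring
  · have h2 : ∀ y : 𝔼 × 𝔼, (2 : C(𝔼 × 𝔼, ℝ)) y = 2 := fun _ => rfl
    ext y
    simp [lineNormSq, inner_smul_right, norm_smul, he, h2]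
    ring

/-- The coefficients of `ξ_{p,q}(K + r e)` as a polynomial in `r`, beyond its degree, vanish. -/
theorem normalIntegral_coeff_eq_zero (hm : Module.finrank ℝ 𝔼 = d - 1 + 1) {p q k l : ℕ}
    (h : IsPolynomialOfDegreeLE (xi p q : ConvexBody 𝔼 → ℝ) k) (hl : k < l) {e : 𝔼}
    (he : ‖e‖ = 1) (K : ConvexBody 𝔼) :
    K.normalIntegral (d - 1) ((lineInner e ^ p * lineNormSq e ^ q).coeff l) = 0 := by
  obtain ⟨P, hP, hev⟩ := h K
  -- Both sides are real polynomials with value `ξ_{p,q}(K + r e)` at every `r`, so they coincide.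
  have heq : MvPolynomial.aeval (fun i => Polynomial.C (e i) * (Polynomial.X : Polynomial ℝ)) P =
      (lineInner e ^ p * lineNormSq e ^ q).integrate (K.normalIntegralₗ hm) := by
    refine Polynomial.funext fun r => ?_
    rw [MvPolynomial.eval_aeval_line, Polynomial.eval_integrate, eval_line p q he,
      normalIntegralₗ_apply, ← xi_translate, hev]
    simp
  rw [← normalIntegralₗ_apply hm, ← Polynomial.coeff_integrate, ← heq]
  exact Polynomial.coeff_eq_zero_of_natDegree_lt
    ((MvPolynomial.natDegree_aeval_line_le P _).trans_lt (hP.trans_lt hl))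

section Bodies

variable {E : Type*} [NormedAddCommGroup E] [InnerProductSpace ℝ E] [FiniteDimensional ℝ E]

/-- The closed unit ball. -/
def unitBall (E : Type*) [NormedAddCommGroup E] [InnerProductSpace ℝ E] [FiniteDimensional ℝ E] :
    ConvexBody E where
  carrier := Metric.closedBall 0 1
  convex' := convex_closedBall 0 1
  isCompact' := isCompact_closedBall 0 1
  nonempty' := ⟨0, by simp⟩

theorem mem_unitBall {z : E} : z ∈ unitBall E ↔ ‖z‖ ≤ 1 := mem_closedBall_zero_iff

/-- The half of the closed unit ball on the side of `e`. -/
def halfBall (e : E) : ConvexBody E where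
  carrier := Metric.closedBall 0 1 ∩ {z | 0 ≤ ⟪z, e⟫}
  convex' := (convex_closedBall 0 1).inter (convex_halfSpace_ge
    ⟨fun x y => inner_add_left x y e, fun c x => real_inner_smul_left x e c⟩ 0)
  isCompact' := (isCompact_closedBall 0 1).inter_right
    (isClosed_le continuous_const (by fun_prop))
  nonempty' := ⟨0, by simp⟩

theorem mem_halfBall {e z : E} : z ∈ halfBall e ↔ ‖z‖ ≤ 1 ∧ 0 ≤ ⟪z, e⟫ :=
  and_congr mem_closedBall_zero_iff Iff.rfl

theorem normals_unitBall {s n : E} (hn : n ∈ (unitBall E).normals s) : n = s ∧ ‖s‖ = 1 := by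
  have hs := mem_unitBall.1 hn.1
  have h1 := hn.2.2 n (mem_unitBall.2 hn.2.1.le)
  rw [inner_sub_left, real_inner_self_eq_norm_sq, hn.2.1] at h1
  have h2 : ‖n - s‖ ^ 2 ≤ 0 := by
    rw [norm_sub_sq_real, real_inner_comm, hn.2.1]
    nlinarith [norm_nonneg s]
  have h3 : n = s := by
    rw [← sub_eq_zero, ← norm_eq_zero]
    nlinarith [norm_nonneg (n - s)]
  exact ⟨h3, h3 ▸ hn.2.1⟩

variable [MeasurableSpace E] [BorelSpace E] {m : ℕ}

theorem measure_shadow_pos {K : ConvexBody E} {ν : E}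
    (h : ∀ z : E, ‖z‖ ≤ 1 → ⟪z, ν⟫ = 0 → z ∈ K) : 0 < (volume (K.shadow ν)).toReal := by
  refine ENNReal.toReal_pos ?_ isCompact_shadow.measure_lt_top.ne
  refine ((Metric.measure_closedBall_pos volume (0 : normalHyperplane ν) one_pos).trans_le
    (measure_mono fun y hy => ?_)).ne'
  refine ⟨y, h y (by simpa using hy) (inner_coe_normalHyperplane ν y), ?_⟩
  exact Submodule.orthogonalProjectionOnto_mem_subspace_eq_self y

/-- Since `f ≥ 1 ≥ max ⟪n, ν⟫ 0` on the normal bundle, the integral is at least the volume of a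
projection containing a unit ball. -/
theorem normalIntegral_pos (hm : Module.finrank ℝ E = m + 1) {K : ConvexBody E} {ν : E}
    (hν : ‖ν‖ = 1) (h : ∀ z : E, ‖z‖ ≤ 1 → ⟪z, ν⟫ = 0 → z ∈ K) {f : C(E × E, ℝ)}
    (hf : ∀ s, ∀ n ∈ K.normals s, 1 ≤ f (s, n)) : 0 < K.normalIntegral m f := by
  refine (measure_shadow_pos h).trans_le ?_
  rw [← normalIntegral_innerNormalPos hm K hν]
  refine normalIntegral_mono hm K fun s n hn => le_trans ?_ (hf s n hn)
  rw [innerNormalPos_apply]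
  refine max_le ((real_inner_le_norm _ _).trans ?_) zero_le_one
  rw [hn.2.1, hν, one_mul]

theorem halfBall_of_inner_eq_zero {e z : E} (hz : ‖z‖ ≤ 1) (h : ⟪z, e⟫ = 0) : z ∈ halfBall e :=
  mem_halfBall.2 ⟨hz, h.ge⟩

theorem topNormal_neg_halfBall {e : E} (he : ‖e‖ = 1) {y : normalHyperplane (-e)}
    (hy : y ∈ (halfBall e).regularSet (-e)) : (halfBall e).topNormal (-e) y = -e := by
  have he' : ‖-e‖ = 1 := by rwa [norm_neg]
  have hy0 : ⟪(y : E), e⟫ = 0 := by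
    have := inner_coe_normalHyperplane (-e) y
    rwa [inner_neg_right, neg_eq_zero] at this
  have hy1 : ‖(y : E)‖ ≤ 1 := by
    have := (mem_halfBall.1 (topPoint_mem he' (interior_subset hy.1))).1
    rw [← hyperplaneProj_topPoint (K := halfBall e) y]
    exact ((normalHyperplane (-e)).norm_orthogonalProjectionOnto_apply_le _).trans this
  have hn : -e ∈ (halfBall e).normals (y : E) := by
    refine ⟨halfBall_of_inner_eq_zero hy1 hy0, he', fun z hz => ?_⟩
    rw [inner_neg_right, inner_sub_left, hy0]
    linarith [(mem_halfBall.1 hz).2]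
  have hpos : 0 < ⟪-e, -e⟫ := by rw [real_inner_self_eq_norm_sq, he']; norm_num
  have ht := eq_topPoint he' hn hpos
  rw [Submodule.orthogonalProjectionOnto_mem_subspace_eq_self] at ht
  rw [ht] at hn
  exact (eq_topNormal he' hy hn hpos).symm

/-- On the curved side `e` is a normal only at the pole, which is the only point of the half ball
maximizing `⟪·, e⟫` and lies over the origin. -/
theorem inner_topNormal_halfBall_lt_one {e : E} (he : ‖e‖ = 1) {y : normalHyperplane e}
    (hy : y ∈ (halfBall e).regularSet e) (hy0 : y ≠ 0) : ⟪(halfBall e).topNormal e y, e⟫ < 1 := by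
  have hmem := topNormal_mem_normals he hy
  refine (inner_lt_one_iff_real_of_norm_eq_one hmem.2.1 he).2 fun heq => hy0 ?_
  rw [heq] at hmem
  have h1 := hmem.2.2 e (mem_halfBall.2 ⟨he.le, by rw [real_inner_self_eq_norm_sq]; positivity⟩)
  have h2 := (mem_halfBall.1 hmem.1).1
  rw [inner_sub_left, real_inner_self_eq_norm_sq, he] at h1
  have h3 : ‖(halfBall e).topPoint e y - e‖ ^ 2 ≤ 0 := by
    rw [norm_sub_sq_real, he]
    nlinarith [norm_nonneg ((halfBall e).topPoint e y)]
  have h4 : (halfBall e).topPoint e y = e := by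
    rw [← sub_eq_zero, ← norm_eq_zero]
    nlinarith [norm_nonneg ((halfBall e).topPoint e y - e)]
  rw [← hyperplaneProj_topPoint (K := halfBall e) y, h4]
  exact Submodule.orthogonalProjectionOnto_orthogonalComplement_singleton_eq_zero e

theorem innerNormal_pow_succ (e : E) (p : ℕ) : innerNormal e ^ (p + 1) =
    innerNormal e ^ p * innerNormalPos e +
      (-1 : ℝ) ^ (p + 1) • (innerNormal (-e) ^ p * innerNormalPos (-e)) := by
  ext x
  simp only [ContinuousMap.pow_apply, innerNormal_apply, ContinuousMap.add_apply,
    ContinuousMap.mul_apply, innerNormalPos_apply, ContinuousMap.smul_apply, inner_neg_right,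
    smul_eq_mul]
  rcases le_total ⟪x.2, e⟫ 0 with h | h
  · rw [max_eq_right h, max_eq_left (by linarith), mul_zero, zero_add, ← pow_succ, ← mul_pow]
    simp
  · rw [max_eq_left h, max_eq_right (by linarith), pow_succ]
    simp

/-- A half ball is used because on a centrally symmetric body odd powers cancel. For a positive
exponent the flat side contributes plus or minus the volume of the disc, the curved side the
integral over the same disc of a power of `⟪n, e⟫`, one lower than the exponent. For exponent 1 the
two cancel. -/
theorem normalIntegral_halfBall_ne_zero (hm : Module.finrank ℝ E = m + 1) (hm1 : 1 ≤ m) {e : E}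
    (he : ‖e‖ = 1) {p : ℕ} (hp : p ≠ 1) :
    (halfBall e).normalIntegral m (innerNormal e ^ p) ≠ 0 := by
  rcases p with _ | p
  · rw [pow_zero]
    exact (normalIntegral_pos hm he (fun z => halfBall_of_inner_eq_zero) fun _ _ _ => le_rfl).ne'
  have hp0 : p ≠ 0 := fun h => hp (by rw [h])
  have he' : ‖-e‖ = 1 := by rwa [norm_neg]
  have hvol : 0 < (volume ((halfBall e).shadow e)).toReal :=
    measure_shadow_pos fun z => halfBall_of_inner_eq_zero
  have hneg : (halfBall e).normalIntegral m (innerNormal (-e) ^ p * innerNormalPos (-e)) =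
      (volume ((halfBall e).shadow e)).toReal := by
    rw [normalIntegral_mul_innerNormalPos hm _ he', ← volume_shadow_neg hm _ he,
      ← volume_regularSet he']
    have : ∀ y ∈ (halfBall e).regularSet (-e), (innerNormal (-e) ^ p)
        ((halfBall e).topPoint (-e) y, (halfBall e).topNormal (-e) y) = 1 := fun y hy => by
      simp [topNormal_neg_halfBall he hy, he]
    rw [setIntegral_congr_fun measurableSet_regularSet this]
    simp [Measure.real]
  rw [innerNormal_pow_succ, ← normalIntegralₗ_apply hm, map_add, map_smul, normalIntegralₗ_apply,
    normalIntegralₗ_apply, hneg, normalIntegral_mul_innerNormalPos hm _ he, smul_eq_mul]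
  rcases Nat.even_or_odd (p + 1) with hev | hodd
  · rw [hev.neg_one_pow, one_mul]
    refine (add_pos_of_nonneg_of_pos (setIntegral_nonneg measurableSet_regularSet fun y _ => ?_)
      hvol).ne'
    simp only [ContinuousMap.pow_apply, innerNormal_apply, inner_topNormal he]
    exact pow_nonneg (inv_nonneg.2 (areaDensity_pos _).le) _
  -- Cancellation would force `⟪n, e⟫ ^ p = 1` almost everywhere on the disc. As `p ≠ 0` here, this
  -- fails off the centre, a null set because the hyperplane has positive dimension.
  · rw [hodd.neg_one_pow, neg_one_mul, ← sub_eq_add_neg, sub_ne_zero]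
    intro heq
    have hint := integrableOn_topPoint_topNormal (K := halfBall e) he (innerNormal e ^ p)
    have hint1 := integrableOn_topPoint_topNormal (K := halfBall e) he 1
    have hone : ∫ y in (halfBall e).regularSet e, (1 : C(E × E, ℝ))
        ((halfBall e).topPoint e y, (halfBall e).topNormal e y) =
          (volume ((halfBall e).shadow e)).toReal := by
      simp [Measure.real, volume_regularSet he]
    rw [← hone, ← sub_eq_zero, ← neg_eq_zero, neg_sub, ← integral_sub hint1 hint,
      setIntegral_eq_zero_iff_of_nonneg_ae (f := fun y => (1 : C(E × E, ℝ))
        ((halfBall e).topPoint e y, (halfBall e).topNormal e y) - (innerNormal e ^ p)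
        ((halfBall e).topPoint e y, (halfBall e).topNormal e y)) ?_ (hint1.sub hint)] at heq
    · have hnt : Nontrivial (normalHyperplane e) :=
        Module.nontrivial_of_finrank_pos (R := ℝ) (by rw [finrank_normalHyperplane hm he]; omega)
      have hae : ∀ᵐ y : normalHyperplane e, y ∉ (halfBall e).regularSet e := by
        filter_upwards [(ae_restrict_iff' measurableSet_regularSet).1 heq,
          measure_eq_zero_iff_ae_notMem.1 (measure_singleton (μ := volume)
            (0 : normalHyperplane e))] with y hy hy0 hreg
        have h1 := hy hreg
        have h2 := inner_topNormal_halfBall_lt_one he hreg (by simpa using hy0)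
        have h3 : 0 ≤ ⟪(halfBall e).topNormal e y, e⟫ := by
          rw [inner_topNormal he]; exact inv_nonneg.2 (areaDensity_pos _).le
        have h4 := pow_lt_one₀ h3 h2 hp0
        simp at h1
        linarith
      have h0 := measure_eq_zero_iff_ae_notMem.2 hae
      rw [volume_regularSet he] at h0
      rw [h0] at hvol
      simp at hvol
    · filter_upwards [ae_restrict_mem measurableSet_regularSet] with y hy
      have h3 : 0 ≤ ⟪(halfBall e).topNormal e y, e⟫ := by
        rw [inner_topNormal he]; exact inv_nonneg.2 (areaDensity_pos _).le
      have h5 : ⟪(halfBall e).topNormal e y, e⟫ ≤ 1 := by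
        refine (real_inner_le_norm _ _).trans ?_
        rw [norm_topNormal he, he, one_mul]
      have h4 := pow_le_one₀ (n := p) h3 h5
      simpa using h4

/-- On the unit sphere `n = s`, so the integrand is `1 + 2 * q * ⟪n, e⟫ ^ 2`. -/
theorem normalIntegral_unitBall_pos (hm : Module.finrank ℝ E = m + 1) {e : E} (he : ‖e‖ = 1)
    (q : ℕ) : 0 < (unitBall E).normalIntegral m
      (innerPosNormal E + innerNormal e * (q • (2 * innerPos e))) := by
  refine normalIntegral_pos hm he (fun z hz _ => mem_unitBall.2 hz) fun s n hn => ?_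
  obtain ⟨rfl, hs⟩ := normals_unitBall hn
  have h2 : (2 : C(E × E, ℝ)) (n, n) = 2 := rfl
  have h : (0 : ℝ) ≤ q * (⟪n, e⟫ * ⟪n, e⟫) := mul_nonneg (Nat.cast_nonneg q) (mul_self_nonneg _)
  simp [hs, h2]
  nlinarith

end Bodies

end ConvexBody

theorem proposition4p6 (d : ℕ) (hd : 2 ≤ d) (p q : ℕ) :
    (∀ K : ConvexBody (EuclideanSpace ℝ (Fin d)),
      IntegrableOn (ConvexBody.xiIntegrand p q K)
        (frontier (K : Set (EuclideanSpace ℝ (Fin d)))) μHE[d - 1]) ∧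
    ConvexBody.IsOrthogonalInvariant
      (ConvexBody.xi p q : ConvexBody (EuclideanSpace ℝ (Fin d)) → ℝ) ∧
    Continuous (ConvexBody.xi p q : ConvexBody (EuclideanSpace ℝ (Fin d)) → ℝ) ∧
    ConvexBody.IsValuation (ConvexBody.xi p q : ConvexBody (EuclideanSpace ℝ (Fin d)) → ℝ) ∧
    (p ≠ 1 → ConvexBody.HasPolynomialDegree
      (ConvexBody.xi p q : ConvexBody (EuclideanSpace ℝ (Fin d)) → ℝ) (p + 2 * q)) ∧
    (p = 1 → ConvexBody.HasPolynomialDegree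
      (ConvexBody.xi p q : ConvexBody (EuclideanSpace ℝ (Fin d)) → ℝ) (2 * q)) := by
  have hm : Module.finrank ℝ (EuclideanSpace ℝ (Fin d)) = d - 1 + 1 := by
    rw [finrank_euclideanSpace_fin]; omega
  obtain ⟨e, he⟩ : ∃ e : EuclideanSpace ℝ (Fin d), ‖e‖ = 1 :=
    ⟨EuclideanSpace.single ⟨0, by omega⟩ 1, by simp⟩
  refine ⟨ConvexBody.integrableOn_xiIntegrand hm p q, ConvexBody.isOrthogonalInvariant_xi p q,
    ConvexBody.continuous_xi hm p q, ConvexBody.isValuation_xi hm p q, fun hp => ?_, ?_⟩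
  · refine ⟨ConvexBody.isPolynomialOfDegreeLE_xi hm p q, fun k hk => ?_⟩
    by_contra! hlt
    have h0 := ConvexBody.normalIntegral_coeff_eq_zero hm hk hlt he (ConvexBody.halfBall e)
    rw [ConvexBody.coeff_top_line] at h0
    exact ConvexBody.normalIntegral_halfBall_ne_zero hm (by omega) he hp h0
  · rintro rfl
    refine ⟨ConvexBody.isPolynomialOfDegreeLE_xi_one hm q, fun k hk => ?_⟩
    by_contra! hlt
    have h0 := ConvexBody.normalIntegral_coeff_eq_zero hm hk hlt he (ConvexBody.unitBall _)
    -- The assumption `k < 2 * q` gives `q ≠ 0`; for `q = 0` minimality is automatic.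
    rw [ConvexBody.coeff_line_one _ (by omega)] at h0
    exact (ConvexBody.normalIntegral_unitBall_pos hm he q).ne' h0
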